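/- Let $m,n,Q$ be positive integers. Let $Q_Q(\mathbb{R}^m)$ be the set of unordered $Q$-tuples $\sum_{i=1}^Q [\![y_i]\!]$ of points $y_i\in\mathbb{R}^m$ (multiplicities counted), with the metric $$\mathcal{G}\Big(\sum_{i=1}^Q[\![y_i]\!],\sum_{i=1}^Q[\![z_i]\!]\Big)=\min_{\sigma}\Big(\sum_{i=1}^Q|y_i-z_{\sigma(i)}|^2\Big)^{1/2},$$ where $\sigma$ runs through the permutations of $\{1,\dots,Q\}$. Let $B=\{x\in\mathbb{R}^n: |x|\le 1\}$, let $\mathcal{L}^n$ be Lebesgue measure on $\mathbb{R}^n$, and let $f:B\to Q_Q(\mathbb{R}^m)$ be Lipschitzian with respect to $\mathcal{G}$. For $1\le p\le\infty$ the $p$ height of $f$ is $$h_p(f)=\inf_{S\in Q_Q(\mathbb{R}^m)}\big\|\mathcal{G}(f(\cdot),S)\big\|_{L^p(\mathcal{L}^n\llcorner B)}.$$ The function $f$ is approximately strongly affinely approximable at $a\in B$ if there are affine maps $g_1,\dots,g_Q:\mathbb{R}^n\to\mathbb{R}^m$ such that $f(a)=\sum_i[\![g_i(0)]\!]$, such that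 $g_i(0)=g_j(0)$ implies $g_i=g_j$, and such that for every $\varepsilon>0$ the complement in $\mathbb{R}^n$ of $\{x\in B:\mathcal{G}(f(x),\sum_i[\![g_i(x-a)]\!])\le\varepsilon|x-a|\}$ has $\mathcal{L}^n$ density zero at $a$. The $g_i$ are then unique up to order, and $|\mathrm{ap}\,Af(a)|:=(\sum_i|Dg_i|^2)^{1/2}$, where $|Dg_i|$ is the Hilbert--Schmidt norm of the linear part of $g_i$. This is defined for $\mathcal{L}^n$ almost all $a\in B$. For $1\le q\le\infty$ the $q$ tilt of $f$ is $$t_q(f)=\big\||\mathrm{ap}\,Af|\big\|_{L^q(\mathcal{L}^n\llcorner B)}.$$ Then the following two statements hold. 1. If $1\le q<n$ and $q^*=nq/(n-q)$, then there is a positive, finite number $\Gamma$ depending only on $m,n,Q,q$ such that $h_{q^*}(f)\le\Gamma\,t_q(f)$. 2. If $n<q\le\infty$, then there is a positive, finite number $\Gamma$ depending only on $m,n,Q,q$ such that $h_\infty(f)\le\Gamma\,t_q(f)$. -/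

import Mathlib

open MeasureTheory Filter Topology Set
open scoped ENNReal

noncomputable section

namespace QValued

/-- `ℝ^k` with the Euclidean norm. -/
abbrev Eucl (k : ℕ) : Type := EuclideanSpace ℝ (Fin k)

/-- `Q_Q(ℝ^m)`: unordered `Q`-tuples of points of `ℝ^m`, i.e. multisets of cardinality `Q`
(equivalently `(ℝ^m)^Q` modulo permutations, or sums of `Q` Dirac masses). -/
abbrev QSpace (Q m : ℕ) : Type := Sym (Eucl m) Q

/-- The element `⟦y 0⟧ + ⋯ + ⟦y (Q-1)⟧` of `Q_Q(ℝ^m)`. -/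
def qsum {Q m : ℕ} (y : Fin Q → Eucl m) : QSpace Q m :=
  ⟨Finset.univ.val.map y, by simp⟩

/-- The metric `𝒢` on `Q_Q(ℝ^m)`: the infimum of `(∑ |y_i - z_i|²)^{1/2}` over all ways to
enumerate the two `Q`-tuples. -/
def G {Q m : ℕ} (S T : QSpace Q m) : ℝ :=
  sInf {r : ℝ | ∃ y z : Fin Q → Eucl m, qsum y = S ∧ qsum z = T ∧
    r = Real.sqrt (∑ i, ‖y i - z i‖ ^ 2)}

/-- `f` restricted to `A` is Lipschitzian with respect to `𝒢`. -/
def IsLipschitzOn {n Q m : ℕ} (f : Eucl n → QSpace Q m) (A : Set (Eucl n)) : Prop :=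
  ∃ L : ℝ, ∀ x ∈ A, ∀ y ∈ A, G (f x) (f y) ≤ L * ‖x - y‖

/-- The set `B` has `n`-dimensional Lebesgue density zero at `a`. -/
def HasDensityZeroAt {n : ℕ} (B : Set (Eucl n)) (a : Eucl n) : Prop :=
  Tendsto (fun r : ℝ => volume (B ∩ Metric.closedBall a r) / volume (Metric.closedBall a r))
    (𝓝[>] 0) (𝓝 0)

/-- `f`, considered as a function with domain `A`, is approximately strongly affinely approximable
at `a`, with approximation `ap A f(a)(v) = ∑ ⟦g_i(v)⟧` as a function of the displacement `v`:
`f(a) = ∑ ⟦g_i(0)⟧`, the approximate limit of `𝒢(f(x), ∑ ⟦g_i(x - a)⟧) / |x - a|` as `x → a`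
is zero, and those `g_i` which agree at `0` agree identically. -/
structure IsApStrongAffineApprox {n Q m : ℕ} (f : Eucl n → QSpace Q m) (A : Set (Eucl n))
    (a : Eucl n) (g : Fin Q → (Eucl n →ᵃ[ℝ] Eucl m)) : Prop where
  mem : a ∈ A
  value : qsum (fun i => g i 0) = f a
  approx : ∀ ε : ℝ, 0 < ε →
    HasDensityZeroAt {x | x ∈ A ∧ G (f x) (qsum fun i => g i (x - a)) ≤ ε * ‖x - a‖}ᶜ a
  strong : ∀ i j, g i 0 = g j 0 → g i = g j

/-- The norm `(∑ |D g_i|²)^{1/2}` of the affine `Q`-valued function `∑ ⟦g_i⟧`, where `|D g_i|` is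
the Euclidean (Hilbert–Schmidt) norm of the linear part of `g_i`. -/
def affineNorm {n Q m : ℕ} (g : Fin Q → (Eucl n →ᵃ[ℝ] Eucl m)) : ℝ :=
  Real.sqrt (∑ i, ∑ j, ‖(g i).linear (EuclideanSpace.single j 1)‖ ^ 2)

open Classical in
/-- `|ap A f(a)|`. The `g_i` are unique up to their order, so that the choice does not matter. The
value `0` at points where `f` is not approximately strongly affinely approximable is a convention;
for a Lipschitzian `f` these points form a null set of `A`. -/
def apAffineNorm {n Q m : ℕ} (f : Eucl n → QSpace Q m) (A : Set (Eucl n)) (a : Eucl n) : ℝ :=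
  if h : ∃ g, IsApStrongAffineApprox f A a g then affineNorm h.choose else 0

/-- The `q` height `h_q(f, S)` of `f|A` with respect to `S`. -/
def heightWrt {n Q m : ℕ} (q : ℝ≥0∞) (f : Eucl n → QSpace Q m) (A : Set (Eucl n))
    (S : QSpace Q m) : ℝ≥0∞ :=
  eLpNorm (fun x => G (f x) S) q (volume.restrict A)

/-- The `q` height `h_q(f)` of `f|A`. -/
def height {n Q m : ℕ} (q : ℝ≥0∞) (f : Eucl n → QSpace Q m) (A : Set (Eucl n)) : ℝ≥0∞ :=
  ⨅ S : QSpace Q m, heightWrt q f A S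

/-- The `q` tilt `t_q(f)` of `f|A`. -/
def tilt {n Q m : ℕ} (q : ℝ≥0∞) (f : Eucl n → QSpace Q m) (A : Set (Eucl n)) : ℝ≥0∞ :=
  eLpNorm (apAffineNorm f A) q (volume.restrict A)

end QValued

end

open scoped NNReal

/-! ### The metric `G` and optimal enumerations. -/

namespace QValued

/-! Once `G` is known to be a pseudometric, most of the argument concerns Lipschitzian maps `F` into
an arbitrary pseudometric space, with the pointwise Lipschitz constant `pointwiseLip F` in place of
the norm of a derivative. It is an upper gradient: along a Lipschitzian curve, `dist (F ·) S` has
derivative bounded by it (`edist_rpow_le_add_lintegral_pointwiseLip`). The constants obtained do not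
involve the Lipschitz constant of `F`.

The `Q`-valued structure enters in the bound of `pointwiseLip F` by the norm of the approximate
affine approximation almost everywhere (`eLpNorm_pointwiseLip_le_tilt`). Where the number of
distinct values is constant, `F` splits locally into Lipschitzian branches, so Rademacher's theorem
and Lebesgue density give an approximation almost everywhere. As `F` is Lipschitzian, an estimate on
a set of density one extends to all nearby points.

For `q > n`, integration over segments ending at a point gives a Morrey estimate, and a common third
point bounds the oscillation of `F`. For `q < n`, segments between pairs of points give a Poincaré
inequality, which supplies `S = F y`. The inversion in the unit sphere extends `F` from the ball to
a cube, where the Gagliardo–Nirenberg argument for a power of the distance from `S` yields the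
Sobolev inequality (`exists_sobolev_edist`). -/

theorem qsum_eq_qsum_iff {Q m : ℕ} {y z : Fin Q → Eucl m} :
    qsum y = qsum z ↔ ∃ σ : Equiv.Perm (Fin Q), z = y ∘ σ := by
  constructor
  · intro h
    have h' : Finset.univ.val.map y = Finset.univ.val.map z := congrArg Subtype.val h
    -- Equal multiplicities give bijections between the fibres over each value; these glue to a
    -- permutation.
    have hc : ∀ v, Nonempty ({i // z i = v} ≃ {i // y i = v}) := by
      intro v
      refine ⟨Fintype.equivOfCardEq ?_⟩
      have hv := congrArg (Multiset.count v) h'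
      rw [Multiset.count_map, Multiset.count_map] at hv
      rw [Fintype.card_subtype, Fintype.card_subtype]
      simp only [eq_comm (a := v)] at hv
      exact hv.symm
    let e := fun v => (hc v).some
    refine ⟨(Equiv.sigmaFiberEquiv z).symm.trans
      ((Equiv.sigmaCongrRight fun v => (e v)).trans (Equiv.sigmaFiberEquiv y)), ?_⟩
    funext i
    exact ((e (z i)) ⟨i, rfl⟩).2.symm
  · rintro ⟨σ, rfl⟩
    apply Subtype.ext
    simp only [qsum]
    rw [← Multiset.map_map]
    congr 1
    exact (congrArg Finset.val (Finset.map_univ_equiv σ)).symm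

theorem exists_qsum_eq {Q m : ℕ} (S : QSpace Q m) : ∃ y, qsum y = S := by
  obtain ⟨s, hs⟩ := S
  induction s using Quotient.inductionOn with
  | h l =>
    have hl : l.length = Q := by simpa using hs
    subst hl
    refine ⟨fun i => l.get i, Subtype.ext ?_⟩
    simp [qsum]

theorem mem_qsum {Q m : ℕ} {y : Fin Q → Eucl m} {v : Eucl m} :
    v ∈ qsum y ↔ ∃ i, y i = v := by
  simp [qsum, Sym.mem_mk]

theorem bddBelow_enumeration_dist {Q m : ℕ} (S T : QSpace Q m) :
    BddBelow {r : ℝ | ∃ y z : Fin Q → Eucl m, qsum y = S ∧ qsum z = T ∧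
      r = Real.sqrt (∑ i, ‖y i - z i‖ ^ 2)} := by
  refine ⟨0, ?_⟩
  rintro r ⟨y, z, -, -, rfl⟩
  positivity

theorem G_qsum_le {Q m : ℕ} (y z : Fin Q → Eucl m) :
    G (qsum y) (qsum z) ≤ Real.sqrt (∑ i, ‖y i - z i‖ ^ 2) :=
  csInf_le (bddBelow_enumeration_dist _ _) ⟨y, z, rfl, rfl, rfl⟩

/-- Reindexing both tuples by one permutation preserves the sum, so only the relative permutation
counts, and the infimum is a minimum over a finite set. -/
theorem exists_perm_G_eq {Q m : ℕ} (y z : Fin Q → Eucl m) : ∃ σ : Equiv.Perm (Fin Q),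
    G (qsum y) (qsum z) = Real.sqrt (∑ i, ‖y i - z (σ i)‖ ^ 2) := by
  let d : Equiv.Perm (Fin Q) → ℝ := fun σ => Real.sqrt (∑ i, ‖y i - z (σ i)‖ ^ 2)
  obtain ⟨σ, hσ⟩ := Finite.exists_min d
  refine ⟨σ, le_antisymm ?_ ?_⟩
  · have : qsum z = qsum (z ∘ σ) := qsum_eq_qsum_iff.2 ⟨σ, rfl⟩
    rw [this]
    exact G_qsum_le y (z ∘ σ)
  · refine le_csInf ⟨_, y, z, rfl, rfl, rfl⟩ ?_
    rintro r ⟨y', z', hy, hz, rfl⟩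
    obtain ⟨α, rfl⟩ := qsum_eq_qsum_iff.1 hy.symm
    obtain ⟨β, rfl⟩ := qsum_eq_qsum_iff.1 hz.symm
    refine (hσ (α.symm.trans β)).trans (le_of_eq ?_)
    simp only [d]
    congr 1
    rw [← Equiv.sum_comp α]
    simp

theorem sqrt_sum_sq_eq_dist {Q m : ℕ} (y z : Fin Q → Eucl m) :
    Real.sqrt (∑ i, ‖y i - z i‖ ^ 2) = dist (WithLp.toLp 2 y) (WithLp.toLp 2 z) := by
  rw [PiLp.dist_eq_of_L2]
  simp [dist_eq_norm]

theorem exists_enumeration_G_eq {Q m : ℕ} (y : Fin Q → Eucl m) (T : QSpace Q m) :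
    ∃ z, qsum z = T ∧ G (qsum y) T = Real.sqrt (∑ i, ‖y i - z i‖ ^ 2) := by
  obtain ⟨z, rfl⟩ := exists_qsum_eq T
  obtain ⟨σ, hσ⟩ := exists_perm_G_eq y z
  exact ⟨z ∘ σ, (qsum_eq_qsum_iff.2 ⟨σ, rfl⟩).symm, hσ⟩

theorem norm_sub_le_sqrt_sum {Q m : ℕ} (y z : Fin Q → Eucl m) (i : Fin Q) :
    ‖y i - z i‖ ≤ Real.sqrt (∑ i, ‖y i - z i‖ ^ 2) := by
  apply Real.le_sqrt_of_sq_le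
  exact Finset.single_le_sum (f := fun i => ‖y i - z i‖ ^ 2) (fun _ _ => by positivity)
    (Finset.mem_univ i)

theorem G_nonneg {Q m : ℕ} (S T : QSpace Q m) : 0 ≤ G S T := by
  obtain ⟨y, rfl⟩ := exists_qsum_eq S
  obtain ⟨z, -, h⟩ := exists_enumeration_G_eq y T
  rw [h]
  positivity

theorem G_self {Q m : ℕ} (S : QSpace Q m) : G S S = 0 := by
  refine le_antisymm ?_ (G_nonneg _ _)
  obtain ⟨y, rfl⟩ := exists_qsum_eq S
  simpa using G_qsum_le y y

theorem G_comm {Q m : ℕ} (S T : QSpace Q m) : G S T = G T S := by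
  have key : ∀ S T : QSpace Q m, G S T ≤ G T S := by
    intro S T
    obtain ⟨y, rfl⟩ := exists_qsum_eq T
    obtain ⟨z, rfl, h⟩ := exists_enumeration_G_eq y S
    rw [h]
    simpa only [norm_sub_rev] using G_qsum_le z y
  exact le_antisymm (key _ _) (key _ _)

/-- Fix one enumeration of the middle tuple and match both others optimally to it; what remains is
the triangle inequality in an `ℓ²` product. -/
theorem G_triangle {Q m : ℕ} (S T U : QSpace Q m) : G S U ≤ G S T + G T U := by
  obtain ⟨z, rfl⟩ := exists_qsum_eq T
  obtain ⟨y, rfl, hy⟩ := exists_enumeration_G_eq z S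
  obtain ⟨w, rfl, hw⟩ := exists_enumeration_G_eq z U
  rw [G_comm (qsum y) (qsum z), hy, hw]
  refine (G_qsum_le y w).trans ?_
  rw [sqrt_sum_sq_eq_dist, sqrt_sum_sq_eq_dist, sqrt_sum_sq_eq_dist,
    dist_comm (WithLp.toLp 2 z)]
  exact dist_triangle _ _ _

/-- The pseudometric `𝒢` on `Q_Q(ℝ^m)`. -/
@[reducible]
noncomputable def pseudoMetricSpaceG (Q m : ℕ) : PseudoMetricSpace (QSpace Q m) where
  dist := G
  dist_self := G_self
  dist_comm := G_comm
  dist_triangle := G_triangle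

attribute [local instance] pseudoMetricSpaceG

theorem dist_eq_G {Q m : ℕ} (S T : QSpace Q m) : dist S T = G S T := rfl

/-! ### Local branches and almost everywhere affine approximation. -/

/-- The number of distinct points of a `Q`-tuple. -/
noncomputable def numValues {Q m : ℕ} (S : QSpace Q m) : ℕ := {v | v ∈ S}.ncard

theorem numValues_qsum {Q m : ℕ} (y : Fin Q → Eucl m) : numValues (qsum y) = (range y).ncard := by
  simp only [numValues, mem_qsum]
  rfl

/-- With the factor 4, points within `ρ` of different `p i`, `p j` stay at least `2 * ρ` apart. -/
theorem exists_separation {Q m : ℕ} (p : Fin Q → Eucl m) :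
    ∃ ρ : ℝ, 0 < ρ ∧ ∀ i j, p i ≠ p j → 4 * ρ ≤ ‖p i - p j‖ := by
  have h : ∀ᶠ ρ : ℝ in 𝓝[>] 0, ∀ i j, p i ≠ p j → 4 * ρ ≤ ‖p i - p j‖ := by
    simp only [eventually_all]
    intro i j hij
    have hpos : 0 < ‖p i - p j‖ := norm_pos_iff.2 (sub_ne_zero.2 hij)
    have : Iio (‖p i - p j‖ / 4) ∈ 𝓝 (0 : ℝ) := Iio_mem_nhds (by positivity)
    filter_upwards [mem_nhdsWithin_of_mem_nhds this] with ρ hρ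
    have := mem_Iio.1 hρ
    linarith
  obtain ⟨ρ, hρ, h0⟩ := (h.and self_mem_nhdsWithin).exists
  exact ⟨ρ, h0, hρ⟩

/-- The range of `p` is an image of that of `y`; equal finite cardinality makes the map between them
injective. -/
theorem ncard_range_le_of_factorsThrough {α β γ : Type*} [Finite α] {p : α → β} {y : α → γ}
    (h : ∀ i j, y i = y j → p i = p j) :
    (range p).ncard ≤ (range y).ncard ∧
      ((range p).ncard = (range y).ncard → ∀ i j, p i = p j → y i = y j) := by
  rcases isEmpty_or_nonempty α with hα | ⟨⟨i₀⟩⟩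
  · simp [Set.range_eq_empty]
  have : Nonempty β := ⟨p i₀⟩
  obtain ⟨e, he⟩ : ∃ e : γ → β, p = e ∘ y :=
    (Function.factorsThrough_iff p).1 fun i j hij => h i j hij
  have hr : range p = e '' range y := by rw [he, range_comp]
  refine ⟨hr ▸ ncard_image_le (finite_range y), fun hc i j hij => ?_⟩
  have hinj : InjOn e (range y) := injOn_of_ncard_image_eq (hr ▸ hc) (finite_range y)
  refine hinj ⟨i, rfl⟩ ⟨j, rfl⟩ ?_
  simpa [he] using hij

variable {n Q m : ℕ}

/-- Near `a` the values of a Lipschitzian `Q`-valued function at the points where it has as many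
distinct values as at `a` form Lipschitzian branches. -/
theorem exists_local_selection {F : Eucl n → QSpace Q m} {L : ℝ≥0} (hF : LipschitzWith L F)
    (a : Eucl n) : ∃ r > 0, ∃ ψ : Eucl n → Fin Q → Eucl m,
      (∀ x ∈ Metric.ball a r, qsum (ψ x) = F x ∧ numValues (F a) ≤ numValues (F x)) ∧
      (∀ x ∈ Metric.ball a r, ∀ x' ∈ Metric.ball a r, numValues (F x') = numValues (F a) →
        (∀ i j, ψ x i = ψ x j → ψ x' i = ψ x' j) ∧
        ∀ i, dist (ψ x i) (ψ x' i) ≤ L * dist x x') := by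
  obtain ⟨p, hp⟩ := exists_qsum_eq (F a)
  obtain ⟨ρ, hρ, hsep⟩ := exists_separation p
  have hr : 0 < ρ / (L + 1) := by positivity
  have hclose : ∀ x ∈ Metric.ball a (ρ / (L + 1)), G (F a) (F x) < ρ := by
    intro x hx
    calc G (F a) (F x) ≤ L * dist a x := hF.dist_le_mul a x
      _ ≤ (L + 1) * dist a x := by gcongr; linarith
      _ < (L + 1) * (ρ / (L + 1)) := by
          gcongr
          rw [dist_comm]
          exact hx
      _ = ρ := by field_simp
  have hsel : ∀ x, ∃ y, x ∈ Metric.ball a (ρ / (L + 1)) →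
      qsum y = F x ∧ ∀ i, ‖p i - y i‖ < ρ := by
    intro x
    obtain ⟨y, hy, hG⟩ := exists_enumeration_G_eq p (F x)
    refine ⟨y, fun hx => ⟨hy, fun i => ?_⟩⟩
    refine (norm_sub_le_sqrt_sum p y i).trans_lt ?_
    rw [← hG, hp]
    exact hclose x hx
  choose ψ hψ using hsel
  -- Values closer than `2 * ρ` belong to the same cluster, i.e. lie near the same point of `F a`.
  have hdist : ∀ x ∈ Metric.ball a (ρ / (L + 1)), ∀ x' ∈ Metric.ball a (ρ / (L + 1)),
      ∀ i j, ‖ψ x i - ψ x' j‖ < 2 * ρ → p i = p j := by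
    intro x hx x' hx' i j hij
    by_contra hne
    have h1 := hsep i j hne
    have h2 := (hψ x hx).2 i
    have h3 := (hψ x' hx').2 j
    have h4 : p i - p j = (p i - ψ x i) + (ψ x i - ψ x' j) - (p j - ψ x' j) := by abel
    have h5 : ‖p i - p j‖ ≤ ‖p i - ψ x i‖ + ‖ψ x i - ψ x' j‖ + ‖p j - ψ x' j‖ := by
      rw [h4]
      exact (norm_sub_le _ _).trans (add_le_add_left (norm_add_le _ _) _)
    linarith
  have hfac : ∀ x ∈ Metric.ball a (ρ / (L + 1)), ∀ i j, ψ x i = ψ x j → p i = p j := by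
    intro x hx i j hij
    exact hdist x hx x hx i j (by rw [hij]; simpa using hρ)
  have hnum : ∀ x ∈ Metric.ball a (ρ / (L + 1)), numValues (F x) = (range (ψ x)).ncard := by
    intro x hx
    rw [← (hψ x hx).1, numValues_qsum]
  have hnuma : numValues (F a) = (range p).ncard := by rw [← hp, numValues_qsum]
  refine ⟨_, hr, ψ, fun x hx => ⟨(hψ x hx).1, ?_⟩, fun x hx x' hx' hn => ?_⟩
  · rw [hnum x hx, hnuma]
    exact (ncard_range_le_of_factorsThrough (hfac x hx)).1
  · rw [hnum x' hx', hnuma] at hn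
    have hconst := (ncard_range_le_of_factorsThrough (hfac x' hx')).2 hn.symm
    refine ⟨fun i j hij => hconst i j (hfac x hx i j hij), fun i => ?_⟩
    -- The optimal matching may permute indices, but only within clusters, and `ψ x'` is constant on
    -- each cluster because it has as many values as `F a`.
    obtain ⟨σ, hσ⟩ := exists_perm_G_eq (ψ x) (ψ x')
    have h1 := norm_sub_le_sqrt_sum (ψ x) (ψ x' ∘ σ) i
    simp only [Function.comp_apply] at h1
    rw [← hσ, (hψ x hx).1, (hψ x' hx').1] at h1
    have h2 : G (F x) (F x') < 2 * ρ := by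
      have := G_triangle (F x) (F a) (F x')
      rw [G_comm (F x) (F a)] at this
      linarith [hclose x hx, hclose x' hx']
    have h3 : ψ x' (σ i) = ψ x' i :=
      (hconst _ _ (hdist x hx x' hx' i (σ i) (h1.trans_lt h2))).symm
    rw [h3] at h1
    rw [dist_eq_norm]
    exact h1.trans (hF.dist_le_mul x x')

theorem isOpen_le_numValues {F : Eucl n → QSpace Q m} {L : ℝ≥0} (hF : LipschitzWith L F) (k : ℕ) :
    IsOpen {x | k ≤ numValues (F x)} := by
  rw [Metric.isOpen_iff]
  intro a ha
  obtain ⟨r, hr, ψ, h1, -⟩ := exists_local_selection hF a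
  exact ⟨r, hr, fun x hx => le_trans ha (h1 x hx).2⟩

theorem measurableSet_numValues_eq {F : Eucl n → QSpace Q m} {L : ℝ≥0} (hF : LipschitzWith L F)
    (k : ℕ) : MeasurableSet {x | numValues (F x) = k} := by
  have : {x | numValues (F x) = k} =
      {x | k ≤ numValues (F x)} \ {x | k + 1 ≤ numValues (F x)} := by
    ext x
    simp only [mem_ofPred_eq, Set.mem_sdiff]
    omega
  rw [this]
  exact (isOpen_le_numValues hF k).measurableSet.diff (isOpen_le_numValues hF (k + 1)).measurableSet

/-- Differentiable branches on a set of density one yield a strong affine approximation. -/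
theorem isApStrongAffineApprox_of_selection {F : Eucl n → QSpace Q m} {A E : Set (Eucl n)}
    {b : Eucl n} {ψ : Eucl n → Fin Q → Eucl m} (hA : A ∈ 𝓝 b) (hb : b ∈ E)
    (hψ : ∀ x ∈ E, qsum (ψ x) = F x)
    (hstrong : ∀ i j, ψ b i = ψ b j → ∀ x ∈ E, ψ x i = ψ x j)
    (hdiff : ∀ i, DifferentiableWithinAt ℝ (fun x => ψ x i) E b)
    (hdens : HasDensityZeroAt Eᶜ b) :
    ∃ g, IsApStrongAffineApprox F A b g := by
  classical
  choose D hD using hdiff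
  -- branches that agree at `b` receive the same derivative
  let rep : Fin Q → Fin Q := fun i => (Finset.univ.filter fun j => ψ b j = ψ b i).min' ⟨i, by simp⟩
  have hrep : ∀ i, ψ b (rep i) = ψ b i := by
    intro i
    have := Finset.min'_mem (Finset.univ.filter fun j => ψ b j = ψ b i) ⟨i, by simp⟩
    simpa using this
  have hrep' : ∀ i j, ψ b i = ψ b j → rep i = rep j := by
    intro i j hij
    simp only [rep, hij]
  have hD' : ∀ i, HasFDerivWithinAt (fun x => ψ x i) (D (rep i)) E b := by
    intro i
    refine (hD (rep i)).congr (fun x hx => ?_) (hrep i).symm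
    exact hstrong i (rep i) (hrep i).symm x hx
  let g : Fin Q → (Eucl n →ᵃ[ℝ] Eucl m) := fun i =>
    (D (rep i)).toLinearMap.toAffineMap + AffineMap.const ℝ _ (ψ b i)
  have hg : ∀ i v, g i v = D (rep i) v + ψ b i := fun i v => by simp [g]
  refine ⟨g, mem_of_mem_nhds hA, ?_, fun ε hε => ?_, fun i j hij => ?_⟩
  · simp only [hg, map_zero, zero_add]
    exact hψ b hb
  · have hev : ∀ᶠ x in 𝓝[E] b, x ∈ A ∧ G (F x) (qsum fun i => g i (x - b)) ≤ ε * ‖x - b‖ := by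
      -- The tolerance is chosen so that the sum of `Q` squares satisfies `Q * (ε / (Q + 1)) ^ 2 ≤ ε
      -- ^ 2`.
      have h1 : ∀ᶠ x in 𝓝[E] b, ∀ i,
          ‖ψ x i - ψ b i - D (rep i) (x - b)‖ ≤ (ε / (Q + 1)) * ‖x - b‖ := by
        rw [eventually_all]
        intro i
        exact (hasFDerivWithinAt_iff_isLittleO.1 (hD' i)).def (by positivity)
      filter_upwards [h1, mem_nhdsWithin_of_mem_nhds hA, self_mem_nhdsWithin] with x hx hxA hxE
      refine ⟨hxA, ?_⟩
      rw [← hψ x hxE]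
      refine (G_qsum_le _ _).trans ?_
      apply Real.sqrt_le_iff.2 ⟨by positivity, ?_⟩
      calc ∑ i, ‖ψ x i - g i (x - b)‖ ^ 2
          ≤ ∑ _i : Fin Q, ((ε / (Q + 1)) * ‖x - b‖) ^ 2 := by
            refine Finset.sum_le_sum fun i _ => ?_
            gcongr
            refine le_trans (le_of_eq ?_) (hx i)
            rw [hg]
            congr 1
            abel
        _ = (Q / (Q + 1) ^ 2) * (ε * ‖x - b‖) ^ 2 := by
            simp
            field_simp
        _ ≤ 1 * (ε * ‖x - b‖) ^ 2 := by
            gcongr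
            rw [div_le_one (by positivity)]
            nlinarith [(Nat.cast_nonneg Q : (0 : ℝ) ≤ Q)]
        _ = (ε * ‖x - b‖) ^ 2 := one_mul _
    obtain ⟨δ, hδ, hsub⟩ := Metric.mem_nhdsWithin_iff.1 hev
    refine tendsto_of_tendsto_of_tendsto_of_le_of_le' tendsto_const_nhds hdens
      (Eventually.of_forall fun _ => zero_le) ?_
    have : Iio δ ∈ 𝓝 (0 : ℝ) := Iio_mem_nhds hδ
    filter_upwards [mem_nhdsWithin_of_mem_nhds this] with r hr
    refine ENNReal.div_le_div_right (measure_mono fun x hx => ?_) _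
    refine ⟨fun hxE => hx.1 (hsub ⟨?_, hxE⟩), hx.2⟩
    exact lt_of_le_of_lt (Metric.mem_closedBall.1 hx.2) (mem_Iio.1 hr)
  · simp only [hg, map_zero, zero_add] at hij
    ext v : 1
    rw [hg, hg, hrep' i j hij, hij]

/-- A Lipschitzian `Q`-valued function is approximately strongly affinely approximable at almost
all interior points of its domain. -/
theorem ae_exists_isApStrongAffineApprox {F : Eucl n → QSpace Q m} {L : ℝ≥0}
    (hF : LipschitzWith L F) (A : Set (Eucl n)) :
    ∀ᵐ b, A ∈ 𝓝 b → ∃ g, IsApStrongAffineApprox F A b g := by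
  -- There are countably many strata, on each of which the number of values is constant; on a
  -- stratum, it suffices to argue locally.
  have hk : ∀ k : ℕ, ∀ᵐ b, numValues (F b) = k → A ∈ 𝓝 b →
      ∃ g, IsApStrongAffineApprox F A b g := by
    intro k
    rw [ae_iff]
    apply measure_null_of_locally_null
    intro a ha
    simp only [mem_ofPred_eq, Classical.not_imp] at ha
    obtain ⟨r, hr, ψ, h1, h2⟩ := exists_local_selection hF a
    rw [ha.1] at h2
    set E : Set (Eucl n) := Metric.ball a r ∩ {x | numValues (F x) = k} with hE
    have hEm : MeasurableSet E := measurableSet_ball.inter (measurableSet_numValues_eq hF k)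
    refine ⟨_, inter_mem_nhdsWithin _ (Metric.ball_mem_nhds a hr), ?_⟩
    have hdiff : ∀ᵐ b, ∀ i, b ∈ E → DifferentiableWithinAt ℝ (fun x => ψ x i) E b := by
      rw [ae_all_iff]
      intro i
      apply LipschitzOnWith.ae_differentiableWithinAt_of_mem (C := L)
      apply LipschitzOnWith.of_dist_le_mul
      intro x hx y hy
      exact (h2 x hx.1 y hy.1 hy.2).2 i
    have hgood : ∀ᵐ b, b ∈ E → A ∈ 𝓝 b → ∃ g, IsApStrongAffineApprox F A b g := by
      filter_upwards [hdiff, Besicovitch.ae_tendsto_measure_inter_div_of_measurableSet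
        (volume : Measure (Eucl n)) hEm.compl] with b hbd hbt hbE hbA
      refine isApStrongAffineApprox_of_selection hbA hbE (fun x hx => (h1 x hx.1).1)
        (fun i j hij x hx => (h2 b hbE.1 x hx.1 hx.2).1 i j hij) (fun i => hbd i hbE) ?_
      simpa [HasDensityZeroAt, hbE] using hbt
    rw [ae_iff] at hgood
    refine measure_mono_null ?_ hgood
    rintro b ⟨hb1, hb2⟩
    simp only [mem_ofPred_eq, Classical.not_imp] at hb1 ⊢
    exact ⟨⟨hb2, hb1.1⟩, hb1.2⟩
  filter_upwards [ae_all_iff.2 hk] with b hb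
  exact hb _ rfl

end QValued

/-! ### The pointwise Lipschitz constant as an upper gradient. -/

/-- The pointwise Lipschitz constant of `F` at `a`: the upper limit of the difference quotients
`d (F x) (F a) / d x a` as `x → a`. -/
noncomputable def pointwiseLip {E X : Type*} [MetricSpace E] [PseudoMetricSpace X] (F : E → X)
    (a : E) : ℝ≥0∞ :=
  ⨅ k : ℕ, ⨆ x : E, ⨆ _ : x ≠ a ∧ dist x a < 1 / ((k : ℝ) + 1), edist (F x) (F a) / edist x a

section PointwiseLip

variable {E X : Type*} [MetricSpace E] [PseudoMetricSpace X] {F : E → X}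

theorem pointwiseLip_le {a : E} {c : ℝ≥0∞}
    (h : ∀ᶠ x in 𝓝 a, edist (F x) (F a) ≤ c * edist x a) : pointwiseLip F a ≤ c := by
  obtain ⟨δ, hδ, hs⟩ := Metric.eventually_nhds_iff.1 h
  obtain ⟨k, hk⟩ := exists_nat_one_div_lt hδ
  refine (iInf_le _ k).trans (iSup₂_le fun x hx => ?_)
  exact ENNReal.div_le_of_le_mul (hs (hx.2.trans hk))

theorem eventually_edist_le_of_pointwiseLip_lt {a : E} {c : ℝ≥0∞} (h : pointwiseLip F a < c) :
    ∀ᶠ x in 𝓝 a, edist (F x) (F a) ≤ c * edist x a := by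
  obtain ⟨k, hk⟩ := iInf_lt_iff.1 h
  filter_upwards [Metric.ball_mem_nhds a (ε := 1 / ((k : ℝ) + 1)) (by positivity)] with x hx
  rcases eq_or_ne x a with rfl | hne
  · simp
  have h1 : edist (F x) (F a) / edist x a ≤ c :=
    (le_iSup₂ (f := fun (x : E) (_ : x ≠ a ∧ dist x a < 1 / ((k : ℝ) + 1)) =>
      edist (F x) (F a) / edist x a) x ⟨hne, hx⟩).trans hk.le
  rwa [ENNReal.div_le_iff (by simpa using hne) (edist_ne_top _ _)] at h1

theorem pointwiseLip_le_of_lipschitzWith {L : ℝ≥0} (hF : LipschitzWith L F) (a : E) :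
    pointwiseLip F a ≤ L :=
  pointwiseLip_le (Eventually.of_forall fun x => hF x a)

/-- For fixed `k` and `x` the constraint on `a` is open and the quotient is continuous there. Hence
each supremum is lower semicontinuous in `a`, and the infimum over `k` is countable. -/
theorem measurable_pointwiseLip [MeasurableSpace E] [OpensMeasurableSpace E] (hF : Continuous F) :
    Measurable (pointwiseLip F) := by
  refine Measurable.iInf fun k => LowerSemicontinuous.measurable ?_
  refine lowerSemicontinuous_iSup fun x => ?_
  intro a y hy
  obtain ⟨⟨hne, hd⟩, hlt⟩ := lt_iSup_iff.1 hy
  have h1 : ∀ᶠ a' in 𝓝 a, x ≠ a' := (eventually_ne_nhds hne.symm).mono fun _ h => h.symm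
  have h2 : ∀ᶠ a' in 𝓝 a, dist x a' < 1 / ((k : ℝ) + 1) :=
    (continuous_const.dist continuous_id).continuousAt.eventually_lt continuousAt_const hd
  have h3 : ContinuousAt (fun a' => edist (F x) (F a') / edist x a') a :=
    ENNReal.Tendsto.div (continuous_const.edist hF).continuousAt (Or.inr (by simpa using hne))
      (continuous_const.edist continuous_id).continuousAt (Or.inr (edist_ne_top _ _))
  filter_upwards [h1, h2, h3.eventually (lt_mem_nhds hlt)] with a' ha1 ha2 ha3
  exact lt_iSup_iff.2 ⟨⟨ha1, ha2⟩, ha3⟩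

/-- Along a Lipschitzian curve the derivative of the distance of `F` from a fixed point is bounded
by the pointwise Lipschitz constant of `F`. -/
theorem enorm_deriv_dist_comp_le {K L : ℝ≥0} (hF : LipschitzWith L F) {c : ℝ → E}
    (hc : LipschitzWith K c) (S : X) (t : ℝ) :
    ‖deriv (fun s => dist (F (c s)) S) t‖ₑ ≤ K * pointwiseLip F (c t) := by
  have hfin : pointwiseLip F (c t) ≠ ∞ :=
    ((pointwiseLip_le_of_lipschitzWith hF _).trans_lt ENNReal.coe_lt_top).ne
  obtain ⟨P, hP⟩ : ∃ P : ℝ≥0, (P : ℝ≥0∞) = pointwiseLip F (c t) :=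
    ⟨_, ENNReal.coe_toNNReal hfin⟩
  rw [← hP]
  refine ENNReal.le_of_forall_pos_le_add fun ε hε _ => ?_
  have hlt : pointwiseLip F (c t) < ((P + ε / (K + 1) : ℝ≥0) : ℝ≥0∞) := by
    rw [← hP, ENNReal.coe_lt_coe]
    exact lt_add_of_pos_right _ (by positivity)
  have hev := hc.continuous.continuousAt.eventually (eventually_edist_le_of_pointwiseLip_lt hlt)
  have h1 : ‖deriv (fun s => dist (F (c s)) S) t‖ ≤ ((P + ε / (K + 1) : ℝ≥0) * K : ℝ) := by
    refine norm_deriv_le_of_lip' (by positivity) ?_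
    filter_upwards [hev] with s hs
    rw [edist_nndist, edist_nndist, ← ENNReal.coe_mul, ENNReal.coe_le_coe,
      ← NNReal.coe_le_coe] at hs
    push_cast at hs
    calc ‖dist (F (c s)) S - dist (F (c t)) S‖ ≤ dist (F (c s)) (F (c t)) := by
          rw [Real.norm_eq_abs]
          exact abs_dist_sub_le _ _ _
      _ ≤ (P + ε / (K + 1)) * dist (c s) (c t) := hs
      _ ≤ (P + ε / (K + 1)) * (K * dist s t) := by
          gcongr
          exact hc.dist_le_mul s t
      _ = _ := by
          push_cast
          rw [Real.dist_eq, Real.norm_eq_abs, mul_assoc]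
  have h2 : ‖deriv (fun s => dist (F (c s)) S) t‖₊ ≤ K * P + ε := by
    rw [← NNReal.coe_le_coe]
    refine (le_of_eq (coe_nnnorm _)).trans (h1.trans ?_)
    push_cast
    have : (ε : ℝ) / (K + 1) * K ≤ ε := by
      rw [div_mul_eq_mul_div, div_le_iff₀ (by positivity)]
      nlinarith [ε.2, K.2]
    nlinarith
  rw [enorm_eq_nnnorm]
  exact_mod_cast h2

end PointwiseLip

theorem AbsolutelyContinuousOnInterval.enorm_sub_le_lintegral_deriv {w : ℝ → ℝ} {a b s t : ℝ}
    (hw : AbsolutelyContinuousOnInterval w a b) (hab : a ≤ b) (hs : s ∈ Icc a b)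
    (ht : t ∈ Icc a b) : ‖w t - w s‖ₑ ≤ ∫⁻ τ in Icc a b, ‖deriv w τ‖ₑ := by
  have hst : uIcc s t ⊆ Icc a b := uIcc_subset_Icc hs ht
  have hw' : AbsolutelyContinuousOnInterval w s t := hw.mono (by rwa [uIcc_of_le hab])
  rw [← hw'.integral_deriv_eq_sub, intervalIntegral.intervalIntegral_eq_integral_uIoc,
    enorm_smul]
  have h1 : ‖(if s ≤ t then 1 else -1 : ℝ)‖ₑ = 1 := by split_ifs <;> simp
  rw [h1, one_mul]
  refine (enorm_integral_le_lintegral_enorm _).trans (lintegral_mono_set ?_)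
  exact uIoc_subset_uIcc.trans hst

/-- Since `γ ≥ 1`, the power is of class `C¹` even at zero, hence Lipschitzian on the bounded range
of `u`. -/
theorem absolutelyContinuousOnInterval_rpow_comp {u : ℝ → ℝ} {K : ℝ≥0} (hu : LipschitzWith K u)
    {γ : ℝ} (hγ : 1 ≤ γ) (a b : ℝ) : AbsolutelyContinuousOnInterval (fun t => u t ^ γ) a b := by
  obtain ⟨M, hM⟩ := (isCompact_uIcc (a := a) (b := b)).exists_bound_of_continuousOn
    hu.continuous.continuousOn
  have hd : ContDiffOn ℝ 1 (fun x : ℝ => x ^ γ) (Icc (-M) M) :=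
    (Real.contDiff_rpow_const_of_le (n := 1) (by simpa using hγ)).contDiffOn
  obtain ⟨C, hC⟩ := hd.exists_lipschitzOnWith one_ne_zero (convex_Icc _ _) isCompact_Icc
  refine LipschitzOnWith.absolutelyContinuousOnInterval (K := C * K) ?_
  exact hC.comp hu.lipschitzOnWith fun x hx => abs_le.1 (by simpa using hM x hx)

section PointwiseLip

variable {E X : Type*} [MetricSpace E] [PseudoMetricSpace X] {F : E → X}

/-- The pointwise Lipschitz constant is an upper gradient: powers of the distance from a fixed point
vary along a Lipschitzian curve by no more than the integral of the expected derivative. -/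
theorem edist_rpow_le_add_lintegral_pointwiseLip {K L : ℝ≥0} (hF : LipschitzWith L F) {c : ℝ → E}
    (hc : LipschitzWith K c) (S : X) {γ : ℝ} (hγ : 1 ≤ γ) {a b s t : ℝ} (hab : a ≤ b)
    (hs : s ∈ Icc a b) (ht : t ∈ Icc a b) :
    edist (F (c t)) S ^ γ ≤ edist (F (c s)) S ^ γ +
      ∫⁻ τ in Icc a b, ENNReal.ofReal γ * edist (F (c τ)) S ^ (γ - 1) *
        (K * pointwiseLip F (c τ)) := by
  set u : ℝ → ℝ := fun s => dist (F (c s)) S with hu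
  have hu0 : ∀ s, 0 ≤ u s := fun s => dist_nonneg
  have hedist : ∀ s (p : ℝ), 0 ≤ p → edist (F (c s)) S ^ p = ENNReal.ofReal (u s ^ p) := by
    intro s p hp
    rw [edist_dist, ENNReal.ofReal_rpow_of_nonneg (hu0 s) hp]
  have hulip : LipschitzWith (1 * (L * K)) u :=
    (LipschitzWith.dist_left S).comp (hF.comp hc)
  have hac := absolutelyContinuousOnInterval_rpow_comp hulip hγ a b
  have h1 := hac.enorm_sub_le_lintegral_deriv hab hs ht
  have h2 : ∫⁻ τ in Icc a b, ‖deriv (fun t => u t ^ γ) τ‖ₑ ≤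
      ∫⁻ τ in Icc a b, ENNReal.ofReal γ * edist (F (c τ)) S ^ (γ - 1) *
        (K * pointwiseLip F (c τ)) := by
    refine lintegral_mono_ae (ae_restrict_of_ae ?_)
    filter_upwards [hulip.ae_differentiableAt] with τ hτ
    have hd := hτ.hasDerivAt.rpow_const (p := γ) (Or.inr hγ)
    rw [hd.deriv, hedist _ _ (by linarith), ← ENNReal.ofReal_mul (by linarith)]
    have : deriv u τ * γ * u τ ^ (γ - 1) = (γ * u τ ^ (γ - 1)) * deriv u τ := by ring
    rw [this, enorm_mul, Real.enorm_of_nonneg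
      (mul_nonneg (by linarith) (Real.rpow_nonneg (hu0 τ) _))]
    gcongr
    exact enorm_deriv_dist_comp_le hF hc S τ
  rw [hedist _ _ (by linarith), hedist _ _ (by linarith)]
  calc ENNReal.ofReal (u t ^ γ) ≤ ENNReal.ofReal (u s ^ γ + ‖u t ^ γ - u s ^ γ‖) := by
        apply ENNReal.ofReal_le_ofReal
        have := le_abs_self (u t ^ γ - u s ^ γ)
        rw [Real.norm_eq_abs]
        linarith
    _ = ENNReal.ofReal (u s ^ γ) + ‖u t ^ γ - u s ^ γ‖ₑ := by
        rw [ENNReal.ofReal_add (Real.rpow_nonneg (hu0 s) _) (norm_nonneg _), ofReal_norm]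
    _ ≤ _ := by
        gcongr
        exact h1.trans h2

end PointwiseLip

/-! ### Folding space onto the unit ball by inversion. -/

section BallFold

variable {E : Type*} [NormedAddCommGroup E] [InnerProductSpace ℝ E]

/-- The retraction onto the closed unit ball which is the inversion in the unit sphere outside of
that ball. -/
noncomputable def ballFold (x : E) : E := (max 1 (‖x‖ ^ 2))⁻¹ • x

theorem ballFold_eq_self {x : E} (hx : x ∈ Metric.closedBall (0 : E) 1) : ballFold x = x := by
  have h : ‖x‖ ≤ 1 := by simpa using hx
  have h2 : ‖x‖ ^ 2 ≤ 1 := by nlinarith [norm_nonneg x]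
  simp [ballFold, h2]

theorem ballFold_of_one_le {x : E} (hx : 1 ≤ ‖x‖) : ballFold x = (‖x‖ ^ 2)⁻¹ • x := by
  rw [ballFold, max_eq_right (by nlinarith)]

theorem ballFold_mem (x : E) : ballFold x ∈ Metric.closedBall (0 : E) 1 := by
  rcases le_total ‖x‖ 1 with h | h
  · rw [ballFold_eq_self (by simpa using h)]
    simpa using h
  · rw [ballFold_of_one_le h, mem_closedBall_zero_iff, norm_smul, norm_inv, norm_pow, norm_norm]
    have : 0 < ‖x‖ := by linarith
    rw [inv_mul_le_iff₀ (by positivity)]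
    nlinarith

/-- With `Y = ‖y‖ ^ 2` and `s` the inner product, the squared distances differ by `(Y - 1) * (Y + 1
- 2 * s) / Y`, which is nonnegative as `2 * s ≤ ‖x‖ ^ 2 + Y ≤ 1 + Y`. -/
theorem norm_sub_ballFold_le {x y : E} (hx : ‖x‖ ≤ 1) (hy : 1 ≤ ‖y‖) :
    ‖x - ballFold y‖ ≤ ‖x - y‖ := by
  have hy0 : 0 < ‖y‖ := by linarith
  refine le_of_sq_le_sq ?_ (norm_nonneg _)
  rw [ballFold_of_one_le hy, norm_sub_sq_real, norm_sub_sq_real, inner_smul_right, norm_smul,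
    norm_inv, norm_pow, norm_norm]
  have hin := real_inner_le_norm x y
  set s := inner ℝ x y
  have h1 : ((‖y‖ ^ 2)⁻¹ * ‖y‖) ^ 2 = (‖y‖ ^ 2)⁻¹ := by field_simp
  rw [h1]
  set Y := ‖y‖ ^ 2 with hY
  have hY1 : 1 ≤ Y := by nlinarith
  have hs : 2 * s ≤ 1 + Y := by nlinarith [sq_nonneg (‖x‖ - ‖y‖), norm_nonneg x]
  have h2 : Y - 2 * s - (Y⁻¹ - 2 * (Y⁻¹ * s)) = Y⁻¹ * ((Y - 1) * (Y + 1 - 2 * s)) := by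
    field_simp
    ring
  have h3 : 0 ≤ Y⁻¹ * ((Y - 1) * (Y + 1 - 2 * s)) :=
    mul_nonneg (by positivity) (mul_nonneg (by linarith) (by linarith))
  linarith

theorem norm_inversion_sub_inversion {x y : E} (hx : x ≠ 0) (hy : y ≠ 0) :
    ‖(‖x‖ ^ 2)⁻¹ • x - (‖y‖ ^ 2)⁻¹ • y‖ = (‖x‖ * ‖y‖)⁻¹ * ‖x - y‖ := by
  have hx0 : 0 < ‖x‖ := norm_pos_iff.2 hx
  have hy0 : 0 < ‖y‖ := norm_pos_iff.2 hy
  rw [← sq_eq_sq₀ (norm_nonneg _) (by positivity), mul_pow, norm_sub_sq_real, norm_sub_sq_real,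
    inner_smul_right, real_inner_smul_left, norm_smul, norm_smul, norm_inv, norm_inv, norm_pow,
    norm_pow, norm_norm, norm_norm]
  field_simp
  ring

theorem lipschitzWith_ballFold : LipschitzWith 1 (ballFold : E → E) := by
  refine LipschitzWith.of_dist_le_mul fun x y => ?_
  rw [NNReal.coe_one, one_mul, dist_eq_norm, dist_eq_norm]
  rcases le_total ‖x‖ 1 with hx | hx <;> rcases le_total ‖y‖ 1 with hy | hy
  · rw [ballFold_eq_self (by simpa using hx), ballFold_eq_self (by simpa using hy)]
  · rw [ballFold_eq_self (by simpa using hx)]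
    exact norm_sub_ballFold_le hx hy
  · rw [ballFold_eq_self (x := y) (by simpa using hy), norm_sub_rev (ballFold x), norm_sub_rev x y]
    exact norm_sub_ballFold_le hy hx
  · have hx0 : x ≠ 0 := norm_pos_iff.1 (by linarith)
    have hy0 : y ≠ 0 := norm_pos_iff.1 (by linarith)
    rw [ballFold_of_one_le hx, ballFold_of_one_le hy, norm_inversion_sub_inversion hx0 hy0]
    refine mul_le_of_le_one_left (norm_nonneg _) (inv_le_one_of_one_le₀ ?_)
    nlinarith

variable [FiniteDimensional ℝ E] [MeasurableSpace E] [BorelSpace E]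

theorem LipschitzOnWith.volume_image_le {f : E → E} {K : ℝ≥0} {s : Set E}
    (hf : LipschitzOnWith K f s) :
    volume (f '' s) ≤ (K : ℝ≥0∞) ^ Module.finrank ℝ E * volume s := by
  have h := hf.hausdorffMeasure_image_le (d := Module.finrank ℝ E) (by positivity)
  rw [Measure.isAddLeftInvariant_eq_smul (volume : Measure E) μH[Module.finrank ℝ E]]
  simp only [Measure.smul_apply, ENNReal.smul_def, smul_eq_mul]
  rw [ENNReal.rpow_natCast] at h
  rw [mul_left_comm]
  gcongr

/-- On bounded sets the fold onto the unit ball distorts volume by at most a bounded factor. -/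
theorem map_ballFold_le {R : ℝ≥0} {s : Set E} (hs : s ⊆ Metric.closedBall 0 R) :
    Measure.map ballFold (volume.restrict s) ≤
      (1 + ((R : ℝ≥0∞) ^ 2) ^ Module.finrank ℝ E) • volume.restrict (Metric.closedBall (0 : E) 1) := by
  have hm : Measurable (ballFold : E → E) := lipschitzWith_ballFold.continuous.measurable
  refine Measure.le_iff.2 fun A hA => ?_
  rw [Measure.map_apply hm hA, Measure.restrict_apply (hm hA), Measure.smul_apply,
    Measure.restrict_apply hA, smul_eq_mul, add_mul, one_mul]
  let inv : E → E := fun x => (‖x‖ ^ 2)⁻¹ • x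
  let D : Set E := {x | x ∈ A ∩ Metric.closedBall 0 1 ∧ x ≠ 0 ∧ ‖x‖⁻¹ ≤ R}
  -- The part outside the unit ball is an image under the inversion of points with norm at least `1
  -- / R`, where the inversion has Lipschitz constant `R ^ 2`.
  have hsub : ballFold ⁻¹' A ∩ s ⊆ (A ∩ Metric.closedBall 0 1) ∪ inv '' D := by
    rintro x ⟨hxA, hxs⟩
    rcases le_total ‖x‖ 1 with h | h
    · left
      have hx1 : x ∈ Metric.closedBall (0 : E) 1 := by simpa using h
      rw [mem_preimage, ballFold_eq_self hx1] at hxA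
      exact ⟨hxA, hx1⟩
    · right
      have hx0 : 0 < ‖x‖ := by linarith
      have hnorm : ‖ballFold x‖ = ‖x‖⁻¹ := by
        rw [ballFold_of_one_le h, norm_smul, norm_inv, norm_pow, norm_norm]
        field_simp
      refine ⟨ballFold x, ⟨⟨hxA, ballFold_mem x⟩, ?_, ?_⟩, ?_⟩
      · rw [← norm_pos_iff, hnorm]
        positivity
      · rw [hnorm, inv_inv]
        simpa using hs hxs
      · simp only [inv, hnorm]
        rw [ballFold_of_one_le h, smul_smul]
        field_simp
        simp
  have hlip : LipschitzOnWith (R ^ 2) inv D := by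
    refine LipschitzOnWith.of_dist_le_mul ?_
    rintro x ⟨-, hx, hxR⟩ y ⟨-, hy, hyR⟩
    rw [dist_eq_norm, dist_eq_norm, norm_inversion_sub_inversion hx hy, mul_inv]
    push_cast
    rw [sq]
    gcongr
  calc volume (ballFold ⁻¹' A ∩ s)
      ≤ volume (A ∩ Metric.closedBall 0 1) + volume (inv '' D) :=
        (measure_mono hsub).trans (measure_union_le _ _)
    _ ≤ volume (A ∩ Metric.closedBall 0 1) +
        ((R : ℝ≥0∞) ^ 2) ^ Module.finrank ℝ E * volume (A ∩ Metric.closedBall 0 1) := by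
        gcongr
        refine hlip.volume_image_le.trans ?_
        push_cast
        gcongr
        exact fun x hx => hx.1

end BallFold

/-! ### Comparison of the pointwise Lipschitz constant with the tilt. -/

namespace QValued

attribute [local instance] pseudoMetricSpaceG

variable {n Q m : ℕ}

theorem norm_sq_linear_le (A : Eucl n →ₗ[ℝ] Eucl m) (v : Eucl n) :
    ‖A v‖ ^ 2 ≤ (∑ j, ‖A (EuclideanSpace.single j 1)‖ ^ 2) * ‖v‖ ^ 2 := by
  have hv : v = ∑ j, v j • EuclideanSpace.single j (1 : ℝ) := by
    ext k
    simp [Finset.sum_apply, Pi.single_apply]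
  have h1 : ‖A v‖ ≤ ∑ j, ‖A (EuclideanSpace.single j 1)‖ * ‖v j‖ := by
    conv_lhs => rw [hv, map_sum]
    refine (norm_sum_le _ _).trans (Finset.sum_le_sum fun j _ => ?_)
    rw [map_smul, norm_smul, mul_comm]
  rw [EuclideanSpace.norm_sq_eq v]
  calc ‖A v‖ ^ 2 ≤ (∑ j, ‖A (EuclideanSpace.single j 1)‖ * ‖v j‖) ^ 2 := by gcongr
    _ ≤ _ := Finset.sum_mul_sq_le_sq_mul_sq _ _ _

theorem affineNorm_nonneg (g : Fin Q → (Eucl n →ᵃ[ℝ] Eucl m)) : 0 ≤ affineNorm g :=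
  Real.sqrt_nonneg _

theorem G_qsum_affine_le (g : Fin Q → (Eucl n →ᵃ[ℝ] Eucl m)) (v : Eucl n) :
    G (qsum fun i => g i v) (qsum fun i => g i 0) ≤ affineNorm g * ‖v‖ := by
  refine (G_qsum_le _ _).trans ?_
  refine Real.sqrt_le_iff.2 ⟨mul_nonneg (affineNorm_nonneg g) (norm_nonneg v), ?_⟩
  rw [mul_pow, affineNorm, Real.sq_sqrt (by positivity), Finset.sum_mul]
  refine Finset.sum_le_sum fun i _ => ?_
  have : g i v - g i 0 = (g i).linear v := by
    simpa using ((g i).linearMap_vsub v 0).symm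
  rw [this]
  exact norm_sq_linear_le _ v

/-- A set whose complement has density zero at `a` meets all small balls near `a`. -/
theorem HasDensityZeroAt.eventually_exists_mem {s : Set (Eucl n)} {a : Eucl n}
    (h : HasDensityZeroAt sᶜ a) {η : ℝ} (hη : 0 < η) (hη1 : η ≤ 1) :
    ∀ᶠ x in 𝓝[≠] a, ∃ x' ∈ s, dist x' x ≤ η * dist x a := by
  -- This is the volume ratio of balls of radii `η * dist x a` and `2 * dist x a`; were the smaller
  -- ball about `x` disjoint from `s`, the density bound would fail.
  have hpos : (0 : ℝ≥0∞) < ENNReal.ofReal ((η / 2) ^ n) := by positivity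
  obtain ⟨δ, hδ, hsub⟩ := mem_nhdsGT_iff_exists_Ioo_subset.1 (h.eventually (gt_mem_nhds hpos))
  have hδ' : 0 < δ / 2 := by
    have := mem_Ioi.1 hδ
    positivity
  filter_upwards [mem_nhdsWithin_of_mem_nhds (Metric.ball_mem_nhds a hδ'),
    self_mem_nhdsWithin] with x hx hxa
  have hd : 0 < dist x a := dist_pos.2 hxa
  have hxd := Metric.mem_ball.1 hx
  have hr : 2 * dist x a ∈ Ioo 0 δ := ⟨by positivity, by linarith⟩
  have hlt : volume (sᶜ ∩ Metric.closedBall a (2 * dist x a)) /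
    volume (Metric.closedBall a (2 * dist x a)) < ENNReal.ofReal ((η / 2) ^ n) := hsub hr
  by_contra! hcon
  have hball : Metric.closedBall x (η * dist x a) ⊆
      sᶜ ∩ Metric.closedBall a (2 * dist x a) := by
    intro z hz
    refine ⟨fun hzs => absurd (Metric.mem_closedBall.1 hz) (not_le.2 (hcon z hzs)), ?_⟩
    rw [Metric.mem_closedBall] at hz ⊢
    have := dist_triangle z x a
    nlinarith
  have h0 : volume (Metric.closedBall a (2 * dist x a)) ≠ 0 :=
    (Metric.measure_closedBall_pos _ _ (by positivity)).ne'
  have htop : volume (Metric.closedBall a (2 * dist x a)) ≠ ∞ := measure_closedBall_lt_top.ne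
  rw [ENNReal.div_lt_iff (Or.inl h0) (Or.inl htop)] at hlt
  have hle := (measure_mono (μ := (volume : Measure (Eucl n))) hball).trans_lt hlt
  rw [Measure.addHaar_closedBall _ _ (by positivity), Measure.addHaar_closedBall _ _ (by positivity),
    ← mul_assoc, ← ENNReal.ofReal_mul (by positivity)] at hle
  refine absurd hle (not_lt.2 (le_of_eq ?_))
  congr 2
  simp only [finrank_euclideanSpace, Fintype.card_fin]
  rw [← mul_pow]
  congr 1
  ring

/-- The approximation controls `F` only on a set of density one at `a`. Every `x` near `a` has a
point `x'` of that set within `η * dist x a`, and passing from `x` to `x'` costs at most `L * η *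
dist x a`. -/
theorem IsApStrongAffineApprox.pointwiseLip_le {F : Eucl n → QSpace Q m} {L : ℝ≥0}
    (hF : LipschitzWith L F) {A : Set (Eucl n)} {a : Eucl n}
    {g : Fin Q → (Eucl n →ᵃ[ℝ] Eucl m)} (h : IsApStrongAffineApprox F A a g) :
    pointwiseLip F a ≤ ENNReal.ofReal (affineNorm g) := by
  refine ENNReal.le_of_forall_pos_le_add fun ε hε _ => ?_
  apply _root_.pointwiseLip_le
  have hN := affineNorm_nonneg g
  set N := affineNorm g with hNdef
  -- As `η ≤ 1`, the total slope `L * η + (η + N) * (1 + η)` is at most `N + η * (L + 2 + N) ≤ N +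
  -- ε`.
  set η : ℝ := min 1 (ε / (L + 2 + N)) with hη
  have hden : (0 : ℝ) < L + 2 + N := by positivity
  have hη0 : 0 < η := lt_min one_pos (by positivity)
  have hη1 : η ≤ 1 := min_le_left _ _
  have hη2 : η * (L + 2 + N) ≤ ε := by
    rw [← le_div_iff₀ hden]
    exact min_le_right _ _
  have hev := (h.approx η hη0).eventually_exists_mem hη0 hη1
  rw [eventually_nhdsWithin_iff] at hev
  filter_upwards [hev] with x hx
  rcases eq_or_ne x a with rfl | hne
  · simp
  obtain ⟨x', ⟨-, hx'⟩, hd⟩ := hx hne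
  have h1 : G (F x) (F a) ≤ (N + ε) * dist x a := by
    have t1 := G_triangle (F x) (F x') (F a)
    have t2 := G_triangle (F x') (qsum fun i => g i (x' - a)) (F a)
    have t3 := G_qsum_affine_le g (x' - a)
    rw [h.value, ← hNdef] at t3
    have t4 : G (F x) (F x') ≤ L * dist x x' := hF.dist_le_mul x x'
    rw [dist_comm] at t4
    have t5 : ‖x' - a‖ ≤ (1 + η) * dist x a := by
      rw [← dist_eq_norm]
      linarith [dist_triangle x' x a]
    have hd0 : 0 ≤ dist x a := dist_nonneg
    have t6 : (L : ℝ) * dist x' x ≤ L * (η * dist x a) := by gcongr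
    have t7 : (η + N) * ‖x' - a‖ ≤ (η + N) * ((1 + η) * dist x a) := by gcongr
    have t8 : η * (L + 2 + N) * dist x a ≤ ε * dist x a := by gcongr
    have t9 : η * η * dist x a ≤ η * dist x a := by
      gcongr
      nlinarith
    nlinarith
  rw [edist_dist, edist_dist, ← ENNReal.ofReal_coe_nnreal, ← ENNReal.ofReal_add hN ε.coe_nonneg,
    ← ENNReal.ofReal_mul (by positivity)]
  exact ENNReal.ofReal_le_ofReal h1

theorem ae_pointwiseLip_le_apAffineNorm {F : Eucl n → QSpace Q m} {L : ℝ≥0}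
    (hF : LipschitzWith L F) (A : Set (Eucl n)) :
    ∀ᵐ b, A ∈ 𝓝 b → pointwiseLip F b ≤ ‖apAffineNorm F A b‖ₑ := by
  filter_upwards [ae_exists_isApStrongAffineApprox hF A] with b hb hA
  have h := hb hA
  rw [apAffineNorm, dif_pos h, Real.enorm_of_nonneg (affineNorm_nonneg _)]
  exact h.choose_spec.pointwiseLip_le hF

theorem eLpNorm_pointwiseLip_le_tilt (hn : 0 < n) {F : Eucl n → QSpace Q m} {L : ℝ≥0}
    (hF : LipschitzWith L F) (q : ℝ≥0∞) :
    eLpNorm (pointwiseLip F) q (volume.restrict (Metric.closedBall 0 1)) ≤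
      tilt q F (Metric.closedBall 0 1) := by
  have : Nonempty (Fin n) := ⟨⟨0, hn⟩⟩
  refine eLpNorm_mono_enorm_ae ?_
  rw [ae_restrict_iff' measurableSet_closedBall]
  -- The comparison holds only at interior points of the ball.
  have hsphere : ∀ᵐ b : Eucl n, b ∉ Metric.sphere (0 : Eucl n) 1 :=
    measure_eq_zero_iff_ae_notMem.1 (Measure.addHaar_sphere _ _ _)
  filter_upwards [ae_pointwiseLip_le_apAffineNorm hF (Metric.closedBall 0 1), hsphere]
    with b hb hbs hb1
  rw [enorm_eq_self]
  refine hb (mem_of_superset (Metric.isOpen_ball.mem_nhds ?_) Metric.ball_subset_closedBall)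
  exact lt_of_le_of_ne (Metric.mem_closedBall.1 hb1) hbs

theorem isApStrongAffineApprox_congr {f F : Eucl n → QSpace Q m} {A : Set (Eucl n)}
    (h : EqOn f F A) {a : Eucl n} {g : Fin Q → (Eucl n →ᵃ[ℝ] Eucl m)}
    (hf : IsApStrongAffineApprox f A a g) : IsApStrongAffineApprox F A a g := by
  refine ⟨hf.mem, hf.value.trans (h hf.mem), fun ε hε => ?_, hf.strong⟩
  have hs : {x | x ∈ A ∧ G (F x) (qsum fun i => g i (x - a)) ≤ ε * ‖x - a‖} =
      {x | x ∈ A ∧ G (f x) (qsum fun i => g i (x - a)) ≤ ε * ‖x - a‖} := by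
    ext x
    refine and_congr_right fun hx => ?_
    rw [h hx]
  rw [hs]
  exact hf.approx ε hε

open Classical in
theorem apAffineNorm_congr {f F : Eucl n → QSpace Q m} {A : Set (Eucl n)} (h : EqOn f F A) :
    apAffineNorm f A = apAffineNorm F A := by
  funext a
  have : IsApStrongAffineApprox f A a = IsApStrongAffineApprox F A a := by
    funext g
    exact propext ⟨isApStrongAffineApprox_congr h, isApStrongAffineApprox_congr h.symm⟩
  -- Equal predicates yield the same chosen maps, so uniqueness of the approximation is not needed.
  have key : ∀ P P' : (Fin Q → (Eucl n →ᵃ[ℝ] Eucl m)) → Prop, P = P' →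
      (if h : ∃ g, P g then affineNorm h.choose else 0) =
        if h : ∃ g, P' g then affineNorm h.choose else 0 := by
    rintro P _ rfl
    rfl
  exact key _ _ this

theorem heightWrt_congr {f F : Eucl n → QSpace Q m} {A : Set (Eucl n)} (hA : MeasurableSet A)
    (h : EqOn f F A) (q : ℝ≥0∞) (S : QSpace Q m) : heightWrt q f A S = heightWrt q F A S := by
  refine eLpNorm_congr_ae ?_
  filter_upwards [ae_restrict_mem hA] with x hx
  rw [h hx]

/-- Extension of a Lipschitzian function from the unit ball. -/
theorem exists_lipschitzWith_eqOn_closedBall {f : Eucl n → QSpace Q m}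
    (hf : IsLipschitzOn f (Metric.closedBall 0 1)) :
    ∃ (L : ℝ≥0) (F : Eucl n → QSpace Q m), LipschitzWith L F ∧
      EqOn f F (Metric.closedBall 0 1) := by
  obtain ⟨L, hL⟩ := hf
  refine ⟨L.toNNReal, f ∘ ballFold, LipschitzWith.of_dist_le_mul fun x y => ?_, fun x hx => ?_⟩
  · calc G (f (ballFold x)) (f (ballFold y)) ≤ L * ‖ballFold x - ballFold y‖ :=
          hL _ (ballFold_mem x) _ (ballFold_mem y)
      _ ≤ L.toNNReal * ‖ballFold x - ballFold y‖ := by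
          gcongr
          exact Real.le_coe_toNNReal L
      _ ≤ L.toNNReal * dist x y := by
          gcongr
          rw [← dist_eq_norm]
          simpa using lipschitzWith_ballFold.dist_le_mul x y
  · rw [Function.comp_apply, ballFold_eq_self hx]

end QValued

/-! ### Morrey and Poincaré estimates from integration over segments. -/

section Segments

variable {n : ℕ} {X : Type*} [PseudoMetricSpace X]

local notation "𝔼" => EuclideanSpace ℝ (Fin n)
local notation "𝔹" => Metric.closedBall (0 : EuclideanSpace ℝ (Fin n)) 1

theorem edist_le_lintegral_segment {F : 𝔼 → X} {L : ℝ≥0} (hF : LipschitzWith L F) {x y : 𝔼}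
    (hx : x ∈ 𝔹) (hy : y ∈ 𝔹) : edist (F x) (F y) ≤
      2 * ∫⁻ t in Icc (0 : ℝ) 1, pointwiseLip F (AffineMap.lineMap x y t) := by
  have h := edist_rpow_le_add_lintegral_pointwiseLip hF (lipschitzWith_lineMap (𝕜 := ℝ) x y) (F x)
    le_rfl zero_le_one (s := 0) (t := 1) (by simp) (by simp)
  simp only [AffineMap.lineMap_apply_one, AffineMap.lineMap_apply_zero, ENNReal.rpow_one, edist_self,
    sub_self, ENNReal.rpow_zero, ENNReal.ofReal_one, one_mul, zero_add] at h
  rw [lintegral_const_mul' _ _ ENNReal.coe_ne_top] at h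
  rw [edist_comm]
  refine h.trans ?_
  gcongr
  rw [← edist_nndist, edist_dist]
  refine ENNReal.ofReal_le_of_le_toReal ?_
  rw [ENNReal.toReal_ofNat]
  have h1 := Metric.mem_closedBall.1 hx
  have h2 := Metric.mem_closedBall.1 hy
  have := dist_triangle_right x y 0
  linarith

theorem Measurable.lineMap {α : Type*} [MeasurableSpace α] {f g : α → 𝔼} {t : α → ℝ}
    (hf : Measurable f) (hg : Measurable g) (ht : Measurable t) :
    Measurable fun a => AffineMap.lineMap (f a) (g a) (t a) := by
  simp only [AffineMap.lineMap_apply_module]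
  fun_prop

/-- Contracting the unit ball towards one of its points. -/
theorem map_lineMap_restrict_le {x : 𝔼} (hx : x ∈ 𝔹) {t : ℝ} (ht : 0 < t) (ht1 : t ≤ 1) :
    Measure.map (fun y => AffineMap.lineMap x y t) (volume.restrict 𝔹) ≤
      ENNReal.ofReal ((t ^ n)⁻¹) • volume.restrict 𝔹 := by
  have hm : Measurable (fun y : 𝔼 => AffineMap.lineMap x y t) :=
    measurable_const.lineMap measurable_id measurable_const
  refine Measure.le_iff.2 fun A hA => ?_
  rw [Measure.map_apply hm hA, Measure.restrict_apply (hm hA), Measure.smul_apply,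
    Measure.restrict_apply hA, smul_eq_mul]
  set s := (fun y : 𝔼 => AffineMap.lineMap x y t) ⁻¹' A ∩ 𝔹 with hs
  have himg : AffineMap.homothety x t '' s ⊆ A ∩ 𝔹 := by
    rintro _ ⟨y, ⟨hyA, hyB⟩, rfl⟩
    rw [AffineMap.homothety_eq_lineMap]
    exact ⟨hyA, (convex_closedBall 0 1).lineMap_mem hx hyB ⟨ht.le, ht1⟩⟩
  have h := measure_mono (μ := (volume : Measure 𝔼)) himg
  rw [Measure.addHaar_image_homothety, finrank_euclideanSpace, Fintype.card_fin,
    abs_of_pos (by positivity)] at h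
  calc volume s = ENNReal.ofReal ((t ^ n)⁻¹) * (ENNReal.ofReal (t ^ n) * volume s) := by
        rw [← mul_assoc, ← ENNReal.ofReal_mul (by positivity), inv_mul_cancel₀ (by positivity),
          ENNReal.ofReal_one, one_mul]
    _ ≤ _ := by gcongr

theorem lintegral_comp_lineMap_le {x : 𝔼} (hx : x ∈ 𝔹) {t : ℝ} (ht : 0 < t) (ht1 : t ≤ 1)
    {h : 𝔼 → ℝ≥0∞} (hh : Measurable h) :
    ∫⁻ y in 𝔹, h (AffineMap.lineMap x y t) ≤ ENNReal.ofReal ((t ^ n)⁻¹) * ∫⁻ y in 𝔹, h y := by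
  have hm : Measurable (fun y : 𝔼 => AffineMap.lineMap x y t) :=
    measurable_const.lineMap measurable_id measurable_const
  rw [← lintegral_map hh hm, ← smul_eq_mul, ← lintegral_smul_measure]
  exact lintegral_mono' (map_lineMap_restrict_le hx ht ht1) le_rfl

theorem eLpNorm_comp_lineMap_le {x : 𝔼} (hx : x ∈ 𝔹) {t : ℝ} (ht : 0 < t) (ht1 : t ≤ 1)
    {h : 𝔼 → ℝ≥0∞} (hh : Measurable h) (q : ℝ≥0∞) :
    eLpNorm (fun y => h (AffineMap.lineMap x y t)) q (volume.restrict 𝔹) ≤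
      ENNReal.ofReal (t ^ (-(n * (1 / q).toReal))) * eLpNorm h q (volume.restrict 𝔹) := by
  have hm : Measurable (fun y : 𝔼 => AffineMap.lineMap x y t) :=
    measurable_const.lineMap measurable_id measurable_const
  have h1 : eLpNorm (fun y => h (AffineMap.lineMap x y t)) q (volume.restrict 𝔹) =
      eLpNorm h q (Measure.map (fun y => AffineMap.lineMap x y t) (volume.restrict 𝔹)) :=
    (eLpNorm_map_measure hh.aestronglyMeasurable hm.aemeasurable).symm
  rw [h1]
  refine (eLpNorm_mono_measure _ (map_lineMap_restrict_le hx ht ht1)).trans ?_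
  refine (eLpNorm_smul_measure_le _ _ _ _).trans (le_of_eq ?_)
  rw [smul_eq_mul, ENNReal.ofReal_rpow_of_nonneg (by positivity) ENNReal.toReal_nonneg]
  congr 2
  rw [← Real.rpow_natCast, ← Real.rpow_neg ht.le, ← Real.rpow_mul ht.le, neg_mul]

theorem lintegral_rpow_Icc_lt_top {r : ℝ} (hr : -1 < r) :
    ∫⁻ t in Icc (0 : ℝ) 1, ENNReal.ofReal (t ^ r) < ∞ := by
  have h := (intervalIntegral.intervalIntegrable_rpow' (a := 0) (b := 1) hr).1
  rw [← restrict_Ioc_eq_restrict_Icc]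
  exact Integrable.lintegral_lt_top h

/-- A Morrey type estimate for the mean distance from the value at a point. -/
theorem exists_lintegral_edist_le {q : ℝ≥0∞} (hq : (n : ℝ≥0∞) < q) (hq1 : 1 ≤ q) :
    ∃ C : ℝ≥0∞, C ≠ ∞ ∧ ∀ (F : 𝔼 → X) (L : ℝ≥0), LipschitzWith L F → ∀ x ∈ 𝔹,
      ∫⁻ y in 𝔹, edist (F x) (F y) ≤ C * eLpNorm (pointwiseLip F) q (volume.restrict 𝔹) := by
  set V : ℝ≥0∞ := volume.restrict 𝔹 univ ^ (1 / (1 : ℝ≥0∞).toReal - 1 / q.toReal) with hV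
  -- The contraction by `t` costs `t ^ (-n / q)` in the `q` norm, integrable at zero because `q >
  -- n`; for `q = ∞` the exponent is zero.
  set r : ℝ := -(n * (1 / q).toReal) with hr
  have hr1 : -1 < r := by
    rcases eq_or_ne q ∞ with rfl | hqt
    · simp [hr]
    have hqpos : 0 < q.toReal := ENNReal.toReal_pos (by
      rintro rfl
      simp at hq1) hqt
    have hnq : (n : ℝ) < q.toReal := by
      rw [← ENNReal.toReal_natCast]
      exact (ENNReal.toReal_lt_toReal (ENNReal.natCast_ne_top n) hqt).2 hq
    rw [hr, neg_lt_neg_iff, one_div, ENNReal.toReal_inv, ← div_eq_mul_inv, div_lt_one hqpos]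
    exact hnq
  refine ⟨2 * (∫⁻ t in Icc (0 : ℝ) 1, ENNReal.ofReal (t ^ r)) * V, ?_, fun F L hF x hx => ?_⟩
  · refine ENNReal.mul_ne_top (ENNReal.mul_ne_top (by simp) (lintegral_rpow_Icc_lt_top hr1).ne) ?_
    refine ENNReal.rpow_ne_top_of_nonneg ?_ ?_
    · rcases eq_or_ne q ∞ with rfl | hqt
      · simp
      · have : 1 ≤ q.toReal := by
          rw [← ENNReal.toReal_one]
          exact (ENNReal.toReal_le_toReal (by simp) hqt).2 hq1
        rw [ENNReal.toReal_one, div_one, sub_nonneg, div_le_one (by linarith)]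
        exact this
    · rw [Measure.restrict_apply_univ]
      exact measure_closedBall_lt_top.ne
  have hg : Measurable (pointwiseLip F) := measurable_pointwiseLip hF.continuous
  have hjoint : Measurable (fun z : 𝔼 × ℝ => pointwiseLip F (AffineMap.lineMap x z.1 z.2)) :=
    hg.comp (measurable_const.lineMap measurable_fst measurable_snd)
  set T := eLpNorm (pointwiseLip F) q (volume.restrict 𝔹) with hT
  calc ∫⁻ y in 𝔹, edist (F x) (F y)
      ≤ ∫⁻ y in 𝔹, 2 * ∫⁻ t in Icc (0 : ℝ) 1, pointwiseLip F (AffineMap.lineMap x y t) :=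
        setLIntegral_mono' measurableSet_closedBall fun y hy => edist_le_lintegral_segment hF hx hy
    _ = 2 * ∫⁻ t in Icc (0 : ℝ) 1, ∫⁻ y in 𝔹, pointwiseLip F (AffineMap.lineMap x y t) := by
        rw [lintegral_const_mul' _ _ (by simp)]
        congr 1
        exact lintegral_lintegral_swap hjoint.aemeasurable
    _ ≤ 2 * ∫⁻ t in Icc (0 : ℝ) 1, ENNReal.ofReal (t ^ r) * (T * V) := by
        gcongr 2 * ?_
        rw [← restrict_Ioc_eq_restrict_Icc]
        refine setLIntegral_mono' measurableSet_Ioc fun t ht => ?_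
        have hm : Measurable (fun y : 𝔼 => pointwiseLip F (AffineMap.lineMap x y t)) :=
          hg.comp (measurable_const.lineMap measurable_id measurable_const)
        have h1 := eLpNorm_le_eLpNorm_mul_rpow_measure_univ (μ := volume.restrict 𝔹) hq1
          hm.aestronglyMeasurable
        rw [eLpNorm_one_eq_lintegral_enorm] at h1
        simp only [enorm_eq_self] at h1
        refine h1.trans ?_
        rw [← mul_assoc]
        gcongr
        exact eLpNorm_comp_lineMap_le hx ht.1 ht.2 hg q
    _ = _ := by
        rw [lintegral_mul_const _ (by fun_prop)]
        ring

theorem volume_unitBall_ne_zero : volume 𝔹 ≠ 0 :=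
  (Metric.measure_closedBall_pos _ _ one_pos).ne'

theorem volume_unitBall_ne_top : volume 𝔹 ≠ ∞ := measure_closedBall_lt_top.ne

/-- Average the triangle inequality through `F y` over all `y` in the ball. -/
theorem exists_edist_le_mul_eLpNorm_pointwiseLip {q : ℝ≥0∞} (hq : (n : ℝ≥0∞) < q) (hq1 : 1 ≤ q) :
    ∃ C : ℝ≥0∞, C ≠ ∞ ∧ ∀ (F : 𝔼 → X) (L : ℝ≥0), LipschitzWith L F → ∀ x ∈ 𝔹, ∀ x' ∈ 𝔹,
      edist (F x) (F x') ≤ C * eLpNorm (pointwiseLip F) q (volume.restrict 𝔹) := by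
  obtain ⟨C, hC, h⟩ := exists_lintegral_edist_le (n := n) (X := X) hq hq1
  refine ⟨(volume 𝔹)⁻¹ * (2 * C), ENNReal.mul_ne_top
    (ENNReal.inv_ne_top.2 volume_unitBall_ne_zero) (ENNReal.mul_ne_top (by simp) hC),
    fun F L hF x hx x' hx' => ?_⟩
  set T := eLpNorm (pointwiseLip F) q (volume.restrict 𝔹) with hT
  have hm : ∀ z, Measurable fun y => edist (F z) (F y) := fun z =>
    (continuous_const.edist hF.continuous).measurable
  have h1 : edist (F x) (F x') * volume 𝔹 ≤ 2 * C * T := by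
    calc edist (F x) (F x') * volume 𝔹 = ∫⁻ _ in 𝔹, edist (F x) (F x') := by
          rw [setLIntegral_const]
      _ ≤ ∫⁻ y in 𝔹, (edist (F x) (F y) + edist (F x') (F y)) :=
          lintegral_mono fun y => edist_triangle_right _ _ _
      _ = (∫⁻ y in 𝔹, edist (F x) (F y)) + ∫⁻ y in 𝔹, edist (F x') (F y) :=
          lintegral_add_left (hm x) _
      _ ≤ C * T + C * T := add_le_add (h F L hF x hx) (h F L hF x' hx')
      _ = 2 * C * T := by ring
  rw [mul_assoc, mul_comm, ← div_eq_mul_inv]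
  exact (ENNReal.le_div_iff_mul_le (Or.inl volume_unitBall_ne_zero)
    (Or.inl volume_unitBall_ne_top)).2 h1

theorem lintegral_Icc_rpow_le {h : ℝ → ℝ≥0∞} (hh : Measurable h) {q : ℝ} (hq : 1 ≤ q) :
    (∫⁻ t in Icc (0 : ℝ) 1, h t) ^ q ≤ ∫⁻ t in Icc (0 : ℝ) 1, h t ^ q := by
  have : IsProbabilityMeasure (volume.restrict (Icc (0 : ℝ) 1)) := ⟨by simp⟩
  have h1 := eLpNorm_le_eLpNorm_of_exponent_le (μ := volume.restrict (Icc (0 : ℝ) 1))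
    (p := 1) (q := ENNReal.ofReal q) (by simpa using hq) hh.aestronglyMeasurable
  have hq0 : 0 < q := by linarith
  rw [eLpNorm_one_eq_lintegral_enorm, eLpNorm_eq_lintegral_rpow_enorm_toReal (by simpa using hq0)
    ENNReal.ofReal_ne_top, ENNReal.toReal_ofReal hq0.le] at h1
  simp only [enorm_eq_self] at h1
  calc _ ≤ ((∫⁻ t in Icc (0 : ℝ) 1, h t ^ q) ^ (1 / q)) ^ q := by gcongr
    _ = _ := by rw [← ENNReal.rpow_mul, one_div_mul_cancel hq0.ne', ENNReal.rpow_one]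

/-- The contraction factor `t ^ (-n)` is harmless for `t ≥ 1 / 2`; for smaller `t` exchange the
roles of `x` and `y`. -/
theorem lintegral_lintegral_comp_lineMap_le {h : 𝔼 → ℝ≥0∞} (hh : Measurable h) {t : ℝ}
    (ht : t ∈ Icc (0 : ℝ) 1) :
    ∫⁻ x in 𝔹, ∫⁻ y in 𝔹, h (AffineMap.lineMap x y t) ≤
      2 ^ n * volume 𝔹 * ∫⁻ y in 𝔹, h y := by
  have key : ∀ s : ℝ, 1 / 2 ≤ s → s ≤ 1 → ∫⁻ x in 𝔹, ∫⁻ y in 𝔹, h (AffineMap.lineMap x y s) ≤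
      2 ^ n * volume 𝔹 * ∫⁻ y in 𝔹, h y := by
    intro s hs hs1
    have hs0 : 0 < s := by linarith
    calc ∫⁻ x in 𝔹, ∫⁻ y in 𝔹, h (AffineMap.lineMap x y s)
        ≤ ∫⁻ _ in 𝔹, 2 ^ n * ∫⁻ y in 𝔹, h y := by
          refine setLIntegral_mono' measurableSet_closedBall fun x hx => ?_
          refine (lintegral_comp_lineMap_le hx hs0 hs1 hh).trans ?_
          gcongr
          rw [← inv_pow, ENNReal.ofReal_pow (by positivity)]
          gcongr
          refine ENNReal.ofReal_le_of_le_toReal ?_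
          rw [ENNReal.toReal_ofNat, inv_le_comm₀ hs0 two_pos]
          linarith
      _ = _ := by
          rw [setLIntegral_const]
          ring
  rcases le_total (1 / 2) t with h2 | h2
  · exact key t h2 ht.2
  · have hj : Measurable (fun z : 𝔼 × 𝔼 => h (AffineMap.lineMap z.1 z.2 t)) :=
      hh.comp (measurable_fst.lineMap measurable_snd measurable_const)
    rw [lintegral_lintegral_swap hj.aemeasurable]
    have := key (1 - t) (by linarith) (by linarith [ht.1])
    simpa only [AffineMap.lineMap_apply_one_sub] using this

/-- A Poincaré type inequality. -/
theorem exists_lintegral_edist_rpow_le {F : 𝔼 → X} {L : ℝ≥0} (hF : LipschitzWith L F) {q : ℝ}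
    (hq : 1 ≤ q) : ∃ y ∈ 𝔹, ∫⁻ x in 𝔹, edist (F x) (F y) ^ q ≤
      2 ^ q * 2 ^ n * ∫⁻ x in 𝔹, pointwiseLip F x ^ q := by
  have hq0 : 0 ≤ q := by linarith
  have hg : Measurable (pointwiseLip F) := measurable_pointwiseLip hF.continuous
  have hgq : Measurable (fun x => pointwiseLip F x ^ q) := hg.pow_const q
  have hdist : Measurable (fun z : 𝔼 × 𝔼 => edist (F z.2) (F z.1) ^ q) :=
    (((hF.continuous.comp continuous_snd).edist (hF.continuous.comp continuous_fst)).measurable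
      ).pow_const q
  -- Some `y` does no worse than the average, so the double integral over pairs suffices.
  obtain ⟨y, hy, hle⟩ := exists_le_setLAverage (μ := volume) volume_unitBall_ne_zero
    volume_unitBall_ne_top (hdist.lintegral_prod_right' (ν := volume.restrict 𝔹)).aemeasurable
  refine ⟨y, hy, hle.trans ?_⟩
  rw [setLAverage_eq]
  refine ENNReal.div_le_of_le_mul ?_
  calc ∫⁻ y in 𝔹, ∫⁻ x in 𝔹, edist (F x) (F y) ^ q
      ≤ ∫⁻ y in 𝔹, ∫⁻ x in 𝔹, 2 ^ q *
          ∫⁻ t in Icc (0 : ℝ) 1, pointwiseLip F (AffineMap.lineMap x y t) ^ q := by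
        refine setLIntegral_mono' measurableSet_closedBall fun y hy => ?_
        refine setLIntegral_mono' measurableSet_closedBall fun x hx => ?_
        refine (ENNReal.rpow_le_rpow (edist_le_lintegral_segment hF hx hy) hq0).trans ?_
        rw [ENNReal.mul_rpow_of_nonneg _ _ hq0]
        gcongr
        refine lintegral_Icc_rpow_le ?_ hq
        exact hg.comp (measurable_const.lineMap measurable_const measurable_id)
    _ = 2 ^ q * ∫⁻ t in Icc (0 : ℝ) 1, ∫⁻ y in 𝔹, ∫⁻ x in 𝔹,
          pointwiseLip F (AffineMap.lineMap x y t) ^ q := by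
        have h2 : (2 : ℝ≥0∞) ^ q ≠ ∞ := ENNReal.rpow_ne_top_of_nonneg hq0 (by simp)
        simp only [lintegral_const_mul' _ _ h2]
        congr 1
        have h3 : ∀ y, ∫⁻ x in 𝔹, ∫⁻ t in Icc (0 : ℝ) 1,
            pointwiseLip F (AffineMap.lineMap x y t) ^ q =
            ∫⁻ t in Icc (0 : ℝ) 1, ∫⁻ x in 𝔹, pointwiseLip F (AffineMap.lineMap x y t) ^ q := by
          intro y
          refine lintegral_lintegral_swap (Measurable.aemeasurable ?_)
          exact hgq.comp (measurable_fst.lineMap measurable_const measurable_snd)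
        simp only [h3]
        refine lintegral_lintegral_swap (Measurable.aemeasurable ?_)
        refine Measurable.lintegral_prod_right' (f := fun z : (𝔼 × ℝ) × 𝔼 =>
          pointwiseLip F (AffineMap.lineMap z.2 z.1.1 z.1.2) ^ q) ?_
        exact hgq.comp (measurable_snd.lineMap measurable_fst.fst measurable_fst.snd)
    _ ≤ 2 ^ q * ∫⁻ _ in Icc (0 : ℝ) 1, 2 ^ n * volume 𝔹 * ∫⁻ y in 𝔹, pointwiseLip F y ^ q := by
        gcongr 2 ^ q * ?_
        refine setLIntegral_mono' measurableSet_Icc fun t ht => ?_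
        rw [lintegral_lintegral_swap (Measurable.aemeasurable ?_)]
        · exact lintegral_lintegral_comp_lineMap_le hgq ht
        · exact hgq.comp (measurable_snd.lineMap measurable_fst measurable_const)
    _ = _ := by
        rw [setLIntegral_const]
        simp
        ring

end Segments

/-! ### The Sobolev inequality via a cube. -/

section Sobolev

variable {n : ℕ} {X : Type*} [PseudoMetricSpace X]

local notation "𝔼" => EuclideanSpace ℝ (Fin n)
local notation "𝔹" => Metric.closedBall (0 : EuclideanSpace ℝ (Fin n)) 1

/-- Lebesgue measure on the cube `[-1, 1]^n`. -/
noncomputable def cubeMeasure (n : ℕ) : Measure (Fin n → ℝ) :=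
  Measure.pi fun _ => volume.restrict (Icc (-1 : ℝ) 1)

theorem cubeMeasure_eq_restrict :
    cubeMeasure n = volume.restrict (univ.pi fun _ : Fin n => Icc (-1 : ℝ) 1) := by
  rw [cubeMeasure, volume_pi, Measure.restrict_pi_pi]

theorem ae_cubeMeasure_mem : ∀ᵐ x ∂cubeMeasure n, ∀ i, x i ∈ Icc (-1 : ℝ) 1 := by
  rw [cubeMeasure_eq_restrict]
  filter_upwards [ae_restrict_mem (MeasurableSet.univ_pi fun _ => measurableSet_Icc)] with x hx i
  exact hx i (mem_univ i)

/-- The fold of the space onto the unit ball in coordinates. -/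
noncomputable def coordFold (x : Fin n → ℝ) : 𝔼 := ballFold (WithLp.toLp 2 x)

theorem continuous_coordFold : Continuous (coordFold : (Fin n → ℝ) → 𝔼) :=
  lipschitzWith_ballFold.continuous.comp (PiLp.continuous_toLp 2 _)

theorem lipschitzWith_coordFold_update (x : Fin n → ℝ) (i : Fin n) :
    LipschitzWith 1 fun t : ℝ => (coordFold (Function.update x i t) : 𝔼) := by
  rw [← one_mul (1 : ℝ≥0)]
  refine lipschitzWith_ballFold.comp (LipschitzWith.of_dist_le_mul fun s t => ?_)
  rw [NNReal.coe_one, one_mul, dist_eq_norm]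
  have h : WithLp.toLp 2 (Function.update x i s) - WithLp.toLp 2 (Function.update x i t) =
      EuclideanSpace.single i (s - t) := by
    ext j
    by_cases hj : j = i
    · subst hj
      simp
    · simp [hj]
  rw [h, PiLp.norm_single, Real.dist_eq, Real.norm_eq_abs]

theorem map_coordFold_eq : Measure.map coordFold (cubeMeasure n) =
    Measure.map ballFold (volume.restrict {x : 𝔼 | ∀ i, x i ∈ Icc (-1 : ℝ) 1}) := by
  have hset : (univ.pi fun _ : Fin n => Icc (-1 : ℝ) 1) =
      (WithLp.toLp 2) ⁻¹' {x : 𝔼 | ∀ i, x i ∈ Icc (-1 : ℝ) 1} := by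
    ext x
    exact ⟨fun h i => h i (mem_univ i), fun h i _ => h i⟩
  have hmeas : MeasurableSet {x : 𝔼 | ∀ i, x i ∈ Icc (-1 : ℝ) 1} := by
    have : {x : 𝔼 | ∀ i, x i ∈ Icc (-1 : ℝ) 1} = ⋂ i, (fun x : 𝔼 => x i) ⁻¹' Icc (-1) 1 := by
      ext x
      simp
    rw [this]
    exact MeasurableSet.iInter fun i => measurableSet_Icc.preimage (by fun_prop)
  have h := (PiLp.volume_preserving_toLp (Fin n)).restrict_preimage hmeas
  rw [cubeMeasure_eq_restrict, hset, ← h.map_eq, Measure.map_map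
    lipschitzWith_ballFold.continuous.measurable h.measurable]
  rfl

theorem restrict_closedBall_le_map_coordFold :
    volume.restrict 𝔹 ≤ Measure.map coordFold (cubeMeasure n) := by
  rw [map_coordFold_eq]
  have hm : Measurable (ballFold : 𝔼 → 𝔼) := lipschitzWith_ballFold.continuous.measurable
  refine Measure.le_iff.2 fun A hA => ?_
  rw [Measure.map_apply hm hA, Measure.restrict_apply (hm hA), Measure.restrict_apply hA]
  refine measure_mono fun x hx => ⟨?_, fun i => ?_⟩
  · rw [mem_preimage, ballFold_eq_self hx.2]
    exact hx.1
  · have h1 : ‖x‖ ≤ 1 := by simpa using hx.2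
    exact abs_le.1 ((PiLp.norm_apply_le x i).trans h1)

theorem exists_map_coordFold_le : ∃ C : ℝ≥0∞, C ≠ ∞ ∧
    Measure.map coordFold (cubeMeasure n) ≤ C • volume.restrict 𝔹 := by
  rw [map_coordFold_eq]
  -- The cube lies in the ball of radius `√n`.
  refine ⟨_, ?_, map_ballFold_le (R := NNReal.sqrt n) fun x hx => ?_⟩
  · simp [ENNReal.pow_eq_top_iff]
  · rw [mem_closedBall_zero_iff, EuclideanSpace.norm_eq, Real.coe_sqrt]
    refine Real.sqrt_le_sqrt ?_
    calc ∑ i, ‖x i‖ ^ 2 ≤ ∑ _i : Fin n, (1 : ℝ) := by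
          refine Finset.sum_le_sum fun i _ => ?_
          have : ‖x i‖ ≤ 1 := abs_le.2 (hx i)
          nlinarith [norm_nonneg (x i)]
      _ = _ := by simp

/-- The Gagliardo–Nirenberg inequality on a cube. -/
theorem lintegral_cubeMeasure_rpow_le (hn : 1 < n) {w H : (Fin n → ℝ) → ℝ≥0∞} (hH : Measurable H)
    (h : ∀ x, (∀ i, x i ∈ Icc (-1 : ℝ) 1) → ∀ i,
      w x ≤ ∫⁻ t in Icc (-1 : ℝ) 1, H (Function.update x i t)) :
    ∫⁻ x, w x ^ ((n : ℝ) / (n - 1)) ∂cubeMeasure n ≤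
      (∫⁻ x, H x ∂cubeMeasure n) ^ ((n : ℝ) / (n - 1)) := by
  have hn' : (1 : ℝ) < n := by exact_mod_cast hn
  have hconj : Real.HolderConjugate (Fintype.card (Fin n)) ((n : ℝ) / (n - 1)) := by
    rw [Fintype.card_fin]
    exact Real.HolderConjugate.conjExponent hn'
  refine le_trans (lintegral_mono_ae ?_) (lintegral_prod_lintegral_pow_le
    (fun _ : Fin n => volume.restrict (Icc (-1 : ℝ) 1)) hconj hH)
  filter_upwards [ae_cubeMeasure_mem] with x hx
  rw [Fintype.card_fin]
  -- Each of the `n` equal factors is estimated along a different coordinate direction.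
  calc w x ^ ((n : ℝ) / (n - 1)) = ∏ _i : Fin n, w x ^ ((1 : ℝ) / (n - 1)) := by
        rw [Finset.prod_const, Finset.card_univ, Fintype.card_fin, ← ENNReal.rpow_natCast,
          ← ENNReal.rpow_mul]
        congr 1
        ring
    _ ≤ _ := by
        refine Finset.prod_le_prod' fun i _ => ENNReal.rpow_le_rpow (h x hx i) ?_
        exact div_nonneg zero_le_one (by linarith)

/-- The estimate along coordinate lines behind the Sobolev inequality. -/
theorem edist_rpow_le_lintegral_line {F : 𝔼 → X} {L : ℝ≥0} (hF : LipschitzWith L F) (S : X) {γ : ℝ}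
    (hγ : 1 ≤ γ) {x : Fin n → ℝ} (hx : ∀ i, x i ∈ Icc (-1 : ℝ) 1) (i : Fin n) :
    edist (F (coordFold x)) S ^ γ ≤ ∫⁻ t in Icc (-1 : ℝ) 1,
      ENNReal.ofReal γ * (edist (F (coordFold (Function.update x i t))) S ^ (γ - 1) *
        (edist (F (coordFold (Function.update x i t))) S +
          pointwiseLip F (coordFold (Function.update x i t)))) := by
  set c : ℝ → 𝔼 := fun t => coordFold (Function.update x i t) with hc
  have hclip : LipschitzWith 1 c := lipschitzWith_coordFold_update x i
  have hcx : coordFold x = c (x i) := by simp [hc]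
  set e : ℝ → ℝ≥0∞ := fun t => edist (F (c t)) S with he
  have hem : Measurable e :=
    ((hF.continuous.comp hclip.continuous).edist continuous_const).measurable
  set I := ∫⁻ t in Icc (-1 : ℝ) 1, ENNReal.ofReal γ * e t ^ (γ - 1) * (1 * pointwiseLip F (c t))
    with hI
  have h1 : ∀ s ∈ Icc (-1 : ℝ) 1, e (x i) ^ γ ≤ e s ^ γ + I := fun s hs => by
    simpa only [ENNReal.coe_one] using
      edist_rpow_le_add_lintegral_pointwiseLip hF hclip S hγ (by norm_num) hs (hx i)
  have hvol : volume (Icc (-1 : ℝ) 1) = 2 := by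
    rw [Real.volume_Icc]
    norm_num
  -- No boundary values vanish, so the starting point `s` is averaged over the edge of length 2;
  -- this produces the zeroth order term.
  have h2 : e (x i) ^ γ * 2 ≤ ((∫⁻ s in Icc (-1 : ℝ) 1, e s ^ γ) + I) * 2 := by
    calc e (x i) ^ γ * 2 = ∫⁻ _ in Icc (-1 : ℝ) 1, e (x i) ^ γ := by
          rw [setLIntegral_const, hvol]
      _ ≤ ∫⁻ s in Icc (-1 : ℝ) 1, (e s ^ γ + I) := setLIntegral_mono' measurableSet_Icc h1
      _ = (∫⁻ s in Icc (-1 : ℝ) 1, e s ^ γ) + I * 2 := by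
          rw [lintegral_add_right _ measurable_const, setLIntegral_const, hvol]
      _ ≤ _ := by
          rw [add_mul]
          gcongr
          exact le_mul_of_one_le_right zero_le one_le_two
  rw [ENNReal.mul_le_mul_iff_left (by simp) (by simp)] at h2
  rw [hcx]
  refine h2.trans ?_
  rw [hI, ← lintegral_add_left (hem.pow_const γ)]
  refine lintegral_mono fun t => ?_
  have h3 : e t ^ γ = e t ^ (γ - 1) * e t := by
    conv_lhs => rw [← sub_add_cancel γ 1, ENNReal.rpow_add_of_nonneg _ _ (by linarith) zero_le_one,
      ENNReal.rpow_one]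
  change e t ^ γ + ENNReal.ofReal γ * e t ^ (γ - 1) * (1 * pointwiseLip F (c t)) ≤
    ENNReal.ofReal γ * (e t ^ (γ - 1) * (e t + pointwiseLip F (c t)))
  rw [h3, one_mul, mul_add, mul_add, mul_assoc]
  gcongr ?_ + _
  exact le_mul_of_one_le_left zero_le (by simpa using hγ)

/-- Hölder's inequality with exponents `q / (q - 1)` and `q`; for `q = 1` the first factor must be
trivial, whence `γ = 1`. -/
theorem lintegral_rpow_mul_le {α : Type*} [MeasurableSpace α] (μ : Measure α) {w k : α → ℝ≥0∞}
    (hw : Measurable w) (hk : Measurable k) {q γ p : ℝ} (hq : 1 ≤ q) (hp : (γ - 1) * q = p * (q - 1))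
    (hγ : q = 1 → γ = 1) :
    ∫⁻ x, w x ^ (γ - 1) * k x ∂μ ≤
      (∫⁻ x, w x ^ p ∂μ) ^ (1 - 1 / q) * (∫⁻ x, k x ^ q ∂μ) ^ (1 / q) := by
  rcases hq.eq_or_lt with rfl | hq1
  · simp [hγ rfl]
  have hconj : (Real.conjExponent q).HolderConjugate q := (Real.HolderConjugate.conjExponent hq1).symm
  have h := ENNReal.lintegral_mul_le_Lp_mul_Lq μ hconj (f := fun x => w x ^ (γ - 1))
    (hw.pow_const _).aemeasurable hk.aemeasurable
  refine h.trans (le_of_eq ?_)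
  have h1 : (γ - 1) * Real.conjExponent q = p := by
    rw [Real.conjExponent, ← mul_div_assoc, hp]
    have : q - 1 ≠ 0 := by linarith
    field_simp
  have h2 : 1 / Real.conjExponent q = 1 - 1 / q := by
    have := hconj.inv_add_inv_eq_one
    rw [one_div, one_div]
    linarith
  simp only [← ENNReal.rpow_mul, h1, h2]

theorem rpow_le_of_self_improving {W A : ℝ≥0∞} (hW : W ≠ ∞) {α β : ℝ} (hαβ : β < α)
    (h : W ^ α ≤ A * W ^ β) : W ^ (α - β) ≤ A := by
  rcases eq_or_ne W 0 with rfl | h0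
  · simp [ENNReal.zero_rpow_of_pos (sub_pos.2 hαβ)]
  rw [ENNReal.rpow_sub _ _ h0 hW]
  exact ENNReal.div_le_of_le_mul h

/-- The Sobolev inequality on the unit ball for the distance from a point. -/
theorem exists_sobolev_edist {q : ℝ} (hq : 1 ≤ q) (hqn : q < n) :
    ∃ C : ℝ≥0∞, C ≠ ∞ ∧ ∀ (F : 𝔼 → X) (L : ℝ≥0) (S : X), LipschitzWith L F →
      (∫⁻ x in 𝔹, edist (F x) S ^ (q * n / (n - q))) ^ (1 / (q * n / (n - q))) ≤
        C * ((∫⁻ x in 𝔹, edist (F x) S ^ q) ^ (1 / q) +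
          (∫⁻ x in 𝔹, pointwiseLip F x ^ q) ^ (1 / q)) := by
  obtain ⟨D, hD, hle⟩ := exists_map_coordFold_le (n := n)
  have hn1 : (1 : ℝ) < n := lt_of_le_of_lt hq hqn
  have hn1' : 1 < n := by exact_mod_cast hn1
  have hq0 : 0 < q := by linarith
  have hnq : 0 < (n : ℝ) - q := by linarith
  have hnm : 0 < (n : ℝ) - 1 := by linarith
  set p : ℝ := q * n / (n - q) with hp
  have hp0 : 0 < p := by positivity
  -- This exponent satisfies both `γ * n / (n - 1) = p` and `(γ - 1) * q = p * (q - 1)`, so the same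
  -- integral `W` appears on both sides.
  set γ : ℝ := q * (n - 1) / (n - q) with hγdef
  have hγ : 1 ≤ γ := by
    rw [hγdef, le_div_iff₀ hnq]
    nlinarith
  refine ⟨ENNReal.ofReal γ * D ^ (1 / q), ENNReal.mul_ne_top ENNReal.ofReal_ne_top
    (ENNReal.rpow_ne_top_of_nonneg (by positivity) hD), fun F L S hF => ?_⟩
  set w : (Fin n → ℝ) → ℝ≥0∞ := fun x => edist (F (coordFold x)) S with hw
  set k : (Fin n → ℝ) → ℝ≥0∞ := fun x => pointwiseLip F (coordFold x) with hk
  have hgm : Measurable (pointwiseLip F) := measurable_pointwiseLip hF.continuous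
  have hum : Measurable fun x => edist (F x) S := (hF.continuous.edist continuous_const).measurable
  have hwm : Measurable w := hum.comp continuous_coordFold.measurable
  have hkm : Measurable k := hgm.comp continuous_coordFold.measurable
  have hupper : ∀ h : 𝔼 → ℝ≥0∞, Measurable h →
      (∫⁻ x, h (coordFold x) ^ q ∂cubeMeasure n) ^ (1 / q) ≤
        D ^ (1 / q) * (∫⁻ x in 𝔹, h x ^ q) ^ (1 / q) := by
    intro h hh
    rw [← ENNReal.mul_rpow_of_nonneg _ _ (by positivity),
      ← lintegral_map (f := fun x => h x ^ q) (hh.pow_const q) continuous_coordFold.measurable]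
    gcongr
    rw [← smul_eq_mul, ← lintegral_smul_measure]
    exact lintegral_mono' hle le_rfl
  set W := ∫⁻ x, w x ^ p ∂cubeMeasure n with hWdef
  -- Finiteness allows a power of `W` to be cancelled below; it is the only use of the size of `L`,
  -- which does not enter the bound.
  have hWfin : W ≠ ∞ := by
    have hbound : ∀ x, w x ^ p ≤ (L + edist (F 0) S) ^ p := by
      intro x
      have h1 : edist (coordFold x : 𝔼) 0 ≤ 1 := by
        rw [edist_dist, ENNReal.ofReal_le_one]
        exact ballFold_mem _
      gcongr
      refine (edist_triangle _ (F 0) _).trans ?_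
      gcongr
      exact (hF _ _).trans (mul_le_of_le_one_right zero_le h1)
    have : IsFiniteMeasure (cubeMeasure n) := by
      unfold cubeMeasure
      infer_instance
    refine ((lintegral_mono hbound).trans_lt ?_).ne
    rw [lintegral_const]
    refine ENNReal.mul_lt_top (ENNReal.rpow_lt_top_of_nonneg hp0.le ?_) (measure_lt_top _ _)
    exact ENNReal.add_ne_top.2 ⟨ENNReal.coe_ne_top, edist_ne_top _ _⟩
  have hlower : ∫⁻ x in 𝔹, edist (F x) S ^ p ≤ W := by
    rw [hWdef, ← lintegral_map (f := fun x => edist (F x) S ^ p) (hum.pow_const p)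
      continuous_coordFold.measurable]
    exact lintegral_mono' restrict_closedBall_le_map_coordFold le_rfl
  have hGN := lintegral_cubeMeasure_rpow_le hn1' (w := fun x => w x ^ γ)
    (H := fun x => ENNReal.ofReal γ * (w x ^ (γ - 1) * (w x + k x))) (by fun_prop)
    (fun x hx i => edist_rpow_le_lintegral_line hF S hγ hx i)
  have hγp : γ * ((n : ℝ) / (n - 1)) = p := by
    rw [hγdef, hp]
    field_simp
  simp only [← ENNReal.rpow_mul, hγp] at hGN
  rw [lintegral_const_mul' _ _ ENNReal.ofReal_ne_top] at hGN
  have hHolder := lintegral_rpow_mul_le (cubeMeasure n) hwm (hwm.add hkm) (p := p) (γ := γ) hq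
    (by rw [hγdef, hp]; field_simp; ring) (by rintro rfl; rw [hγdef]; field_simp)
  set A := (∫⁻ x, (w x + k x) ^ q ∂cubeMeasure n) ^ (1 / q) with hA
  have h1 : W ^ (((n : ℝ) - 1) / n) ≤ (ENNReal.ofReal γ * A) * W ^ (1 - 1 / q) := by
    have h := ENNReal.rpow_le_rpow hGN (z := ((n : ℝ) - 1) / n) (by positivity)
    rw [← ENNReal.rpow_mul, div_mul_div_cancel₀ (by positivity), div_self (by positivity),
      ENNReal.rpow_one] at h
    refine h.trans ?_
    rw [mul_assoc, mul_comm A]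
    gcongr
    exact hHolder
  -- The power on the left exceeds that on the right by `1 / q - 1 / n = 1 / p`, positive because `q
  -- < n`.
  have h2 := rpow_le_of_self_improving hWfin (by
    rw [sub_lt_comm]
    have : 1 - ((n : ℝ) - 1) / n = 1 / n := by field_simp; ring
    rw [this]
    exact one_div_lt_one_div_of_lt hq0 hqn) h1
  have h3 : ((n : ℝ) - 1) / n - (1 - 1 / q) = 1 / p := by
    rw [hp]
    field_simp
    ring
  rw [h3] at h2
  calc (∫⁻ x in 𝔹, edist (F x) S ^ p) ^ (1 / p) ≤ W ^ (1 / p) := by gcongr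
    _ ≤ ENNReal.ofReal γ * A := h2
    _ ≤ ENNReal.ofReal γ * ((∫⁻ x, w x ^ q ∂cubeMeasure n) ^ (1 / q) +
          (∫⁻ x, k x ^ q ∂cubeMeasure n) ^ (1 / q)) := by
        gcongr
        exact ENNReal.lintegral_Lp_add_le hwm.aemeasurable hkm.aemeasurable hq
    _ ≤ ENNReal.ofReal γ * (D ^ (1 / q) * (∫⁻ x in 𝔹, edist (F x) S ^ q) ^ (1 / q) +
          D ^ (1 / q) * (∫⁻ x in 𝔹, pointwiseLip F x ^ q) ^ (1 / q)) := by
        gcongr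
        · exact hupper _ hum
        · exact hupper _ hgm
    _ = _ := by ring

end Sobolev

/-! ### Height bounds for `Q`-valued functions. -/

namespace QValued

attribute [local instance] pseudoMetricSpaceG

variable {n Q m : ℕ}

theorem enorm_G (S T : QSpace Q m) : ‖G S T‖ₑ = edist S T := by
  rw [Real.enorm_of_nonneg (G_nonneg S T), edist_dist, dist_eq_G]

theorem heightWrt_top_le {F : Eucl n → QSpace Q m} {S : QSpace Q m} {A : Set (Eucl n)}
    (hA : MeasurableSet A) {c : ℝ≥0∞} (h : ∀ x ∈ A, edist (F x) S ≤ c) : heightWrt ∞ F A S ≤ c := by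
  rw [heightWrt, eLpNorm_exponent_top]
  refine eLpNormEssSup_le_of_ae_enorm_bound ?_
  filter_upwards [ae_restrict_mem hA] with x hx
  rw [enorm_G]
  exact h x hx

theorem heightWrt_eq_lintegral (F : Eucl n → QSpace Q m) (S : QSpace Q m) (A : Set (Eucl n)) {p : ℝ}
    (hp : 0 < p) : heightWrt (ENNReal.ofReal p) F A S =
      (∫⁻ x in A, edist (F x) S ^ p) ^ (1 / p) := by
  rw [heightWrt, eLpNorm_eq_lintegral_rpow_enorm_toReal (by simpa using hp) ENNReal.ofReal_ne_top,
    ENNReal.toReal_ofReal hp.le]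
  simp only [enorm_G]

/-- A bound for globally Lipschitzian functions carries over to functions on the unit ball. -/
theorem height_le_of_lipschitzWith {p q C : ℝ≥0∞} (hC : C ≠ ∞)
    (h : ∀ (F : Eucl n → QSpace Q m) (L : ℝ≥0), LipschitzWith L F →
      height p F (Metric.closedBall 0 1) ≤ C * tilt q F (Metric.closedBall 0 1)) :
    ∃ Γ : ℝ, 0 < Γ ∧ ∀ f : Eucl n → QSpace Q m, IsLipschitzOn f (Metric.closedBall 0 1) →
      height p f (Metric.closedBall 0 1) ≤
        ENNReal.ofReal Γ * tilt q f (Metric.closedBall 0 1) := by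
  refine ⟨C.toReal + 1, by positivity, fun f hf => ?_⟩
  obtain ⟨L, F, hF, hfF⟩ := exists_lipschitzWith_eqOn_closedBall hf
  have h1 : height p f (Metric.closedBall 0 1) = height p F (Metric.closedBall 0 1) :=
    iInf_congr fun S => heightWrt_congr measurableSet_closedBall hfF p S
  have h2 : tilt q f (Metric.closedBall 0 1) = tilt q F (Metric.closedBall 0 1) := by
    rw [tilt, tilt, apAffineNorm_congr hfF]
  rw [h1, h2]
  refine (h F L hF).trans ?_
  gcongr
  rw [← ENNReal.ofReal_toReal hC]
  exact ENNReal.ofReal_le_ofReal (by simp)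

theorem exists_height_le_of_lt (hn : 0 < n) {q : ℝ} (hq : 1 ≤ q) (hqn : q < n) :
    ∃ Γ : ℝ, 0 < Γ ∧ ∀ f : Eucl n → QSpace Q m, IsLipschitzOn f (Metric.closedBall 0 1) →
      height (ENNReal.ofReal (q * n / (n - q))) f (Metric.closedBall 0 1) ≤
        ENNReal.ofReal Γ * tilt (ENNReal.ofReal q) f (Metric.closedBall 0 1) := by
  obtain ⟨C, hC, hS⟩ := exists_sobolev_edist (n := n) (X := QSpace Q m) hq hqn
  have hq0 : 0 < q := by linarith
  have hnq : 0 < (n : ℝ) - q := by linarith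
  have hn' : (0 : ℝ) < n := by linarith
  set D : ℝ≥0∞ := (2 ^ q * 2 ^ n) ^ (1 / q) with hD
  have hDfin : D ≠ ∞ := by
    refine ENNReal.rpow_ne_top_of_nonneg (by positivity) (ENNReal.mul_ne_top ?_ (by simp))
    exact ENNReal.rpow_ne_top_of_nonneg hq0.le (by simp)
  refine height_le_of_lipschitzWith (C := C * (D + 1))
    (ENNReal.mul_ne_top hC (by simpa using hDfin)) fun F L hF => ?_
  -- With the Poincaré point as centre `S = F y`, the zeroth order term of the Sobolev inequality is
  -- bounded by the tilt.
  obtain ⟨y, -, hy⟩ := exists_lintegral_edist_rpow_le hF hq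
  refine (iInf_le _ (F y)).trans ?_
  rw [heightWrt_eq_lintegral _ _ _ (by positivity)]
  refine (hS F L (F y) hF).trans ?_
  have htilt := eLpNorm_pointwiseLip_le_tilt hn hF (ENNReal.ofReal q)
  rw [eLpNorm_eq_lintegral_rpow_enorm_toReal (by simpa using hq0) ENNReal.ofReal_ne_top,
    ENNReal.toReal_ofReal hq0.le] at htilt
  simp only [enorm_eq_self] at htilt
  rw [mul_assoc, add_mul, one_mul]
  gcongr
  refine (ENNReal.rpow_le_rpow hy (by positivity)).trans ?_
  rw [ENNReal.mul_rpow_of_nonneg _ _ (by positivity)]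
  gcongr

theorem exists_height_top_le_of_gt (hn : 0 < n) {q : ℝ≥0∞} (hq : (n : ℝ≥0∞) < q) :
    ∃ Γ : ℝ, 0 < Γ ∧ ∀ f : Eucl n → QSpace Q m, IsLipschitzOn f (Metric.closedBall 0 1) →
      height ∞ f (Metric.closedBall 0 1) ≤
        ENNReal.ofReal Γ * tilt q f (Metric.closedBall 0 1) := by
  have hq1 : 1 ≤ q := le_trans (by exact_mod_cast hn) hq.le
  obtain ⟨C, hC, h⟩ := exists_edist_le_mul_eLpNorm_pointwiseLip (X := QSpace Q m) hq hq1
  refine height_le_of_lipschitzWith hC fun F L hF => ?_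
  refine (iInf_le _ (F 0)).trans ?_
  refine (heightWrt_top_le measurableSet_closedBall fun x hx => h F L hF x hx 0 (by simp)).trans ?_
  gcongr
  exact eLpNorm_pointwiseLip_le_tilt hn hF q

end QValued

theorem mainTheorem8 (m n Q : ℕ) (hm : 0 < m) (hn : 0 < n) (hQ : 0 < Q) :
    (∀ q : ℝ, 1 ≤ q → q < n → ∃ Γ : ℝ, 0 < Γ ∧
      ∀ f : QValued.Eucl n → QValued.QSpace Q m,
        QValued.IsLipschitzOn f (Metric.closedBall 0 1) →
        QValued.height (ENNReal.ofReal (q * n / (n - q))) f (Metric.closedBall 0 1) ≤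
          ENNReal.ofReal Γ * QValued.tilt (ENNReal.ofReal q) f (Metric.closedBall 0 1)) ∧
    (∀ q : ℝ≥0∞, (n : ℝ≥0∞) < q → ∃ Γ : ℝ, 0 < Γ ∧
      ∀ f : QValued.Eucl n → QValued.QSpace Q m,
        QValued.IsLipschitzOn f (Metric.closedBall 0 1) →
        QValued.height ∞ f (Metric.closedBall 0 1) ≤
          ENNReal.ofReal Γ * QValued.tilt q f (Metric.closedBall 0 1)) := by
  exact ⟨fun q hq hqn => QValued.exists_height_le_of_lt hn hq hqn,
    fun q hq => QValued.exists_height_top_le_of_gt hn hq⟩
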